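/- Fix $D\in\mathbb N$; indices run over $1,\dots,D$, and $\partial_{d_1\dots d_k}=\partial_{d_1}\cdots\partial_{d_k}$ is symmetric in the $d_i$. Let $\mathcal A$ be the real graded-commutative polynomial algebra (coefficients independent of the space-time point) generated by the following symbols and all their formal derivatives, subject only to the stated linear symmetries: - the field $T_{[ab]c}$ (even), with $T_{[ab]c}=-T_{[ba]c}$ and $T_{[ab]c}+T_{[ca]b}+T_{[bc]a}=0$; - the ghosts $S_{ab}=S_{ba}$ and $A_{ab}=-A_{ba}$ (odd), and the ghosts of ghosts $C_a$ (even); - the antifields $T^{*[ab]c}$ (odd, with the symmetries of $T$), $T^{*ab}$ (even, no symmetry), $T^{*a}$ (odd). The longitudinal exterior derivative $\gamma$ is the antiderivation of $\mathcal A$ that commutes with the $\partial_a$, vanishes on the antifields, and satisfies $$\gamma T_{[ab]c}=\partial_aS_{bc}-\partial_bS_{ac}+\partial_aA_{bc}-\partial_bA_{ac}-2\partial_cA_{ab},$$ $$\gamma S_{ab}=3(\partial_aC_b+\partial_bC_a),\qquad \gamma A_{ab}=\partial_aC_b-\partial_bC_a,\qquad \gamma C_a=0 .$$ Then $\gamma^2=0$;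 put $H(\gamma)=\ker\gamma/\operatorname{im}\gamma$. Let $F^A_{abc}$ be the totally antisymmetric part of $\partial_cA_{ab}$. For $k\ge 2$ let $E^T_{abcd_1\dots d_k}$ be obtained from $\partial_{d_1\dots d_k}T_{[ab]c}$ by symmetrizing over each row, and then antisymmetrizing over each column (both normalized), of the Young tableau with rows $(a,c,d_1,\dots,d_{k-2})$, $(b,d_{k-1})$, $(d_k)$. Let $F_{[abc]d}=\partial_aT_{[bc]d}+\partial_bT_{[ca]d}+\partial_cT_{[ab]d}$. **(1)** Let $\mathcal B\subset\mathcal A$ be the subalgebra generated by all $C_a$ (undifferentiated), all $F^A_{abc}$ (undifferentiated), all $E^T_{abcd_1\dots d_k}$ with $k\ge2$, and all antifields and their derivatives. Then $\mathcal B\subset\ker\gamma$, and the map $\mathcal B\to H(\gamma)$, $b\mapsto[b]$, is bijective. **(2)** For every $k\ge2$, the components $E^T_{abcd_1\dots d_k}$ span the same space as the derivatives of order $k-2$ of the curl $\partial_dF_{[abc]e}-\partial_eF_{[abc]d}$ of the field strength. **(3)** Let $f$ be a local function of the fields, that is, a polynomial in $T_{[ab]c}$ and its derivatives. Call $f$ strictly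 gauge invariant if its values are unchanged under $T_{[ab]c}\mapsto T_{[ab]c}+\partial_a\epsilon_{bc}-\partial_b\epsilon_{ac}+\partial_a\eta_{bc}-\partial_b\eta_{ac}-2\partial_c\eta_{ab}$ for all fields $T$, all symmetric $\epsilon_{ab}$ and all antisymmetric $\eta_{ab}$ (equivalently, for all jets of such functions at a point). Then $f$ is strictly gauge invariant if and only if $\gamma f=0$, and if and only if $f$ is a polynomial in the $E^T_{abcd_1\dots d_k}$, $k\ge2$. In that case $f$ is a polynomial in derivatives of $T$ of order at least two, and if $f$ involves only $T$ and its first derivatives, then $f$ is a constant. -/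

import Mathlib

noncomputable section

namespace MixedGauge

/-- The symbols generating the algebra. A multiset `α = {d₁, …, d_k}` of indices stands for the
derivative `∂_{d₁} ⋯ ∂_{d_k}`, so that `∂_a ∂_α` is `a ::ₘ α`. -/
inductive Var (D : ℕ) : Type
  /-- `∂_α T_{[ab]c}` -/
  | T (α : Multiset (Fin D)) (a b c : Fin D) : Var D
  /-- `∂_α S_{ab}` -/
  | S (α : Multiset (Fin D)) (a b : Fin D) : Var D
  /-- `∂_α A_{ab}` -/
  | A (α : Multiset (Fin D)) (a b : Fin D) : Var D
  /-- `∂_α C_a` -/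
  | C (α : Multiset (Fin D)) (a : Fin D) : Var D
  /-- `∂_α T^{*[ab]c}` (antighost number 1) -/
  | antiT (α : Multiset (Fin D)) (a b c : Fin D) : Var D
  /-- `∂_α T^{*ab}` (antighost number 2) -/
  | antiGhost (α : Multiset (Fin D)) (a b : Fin D) : Var D
  /-- `∂_α T^{*a}` (antighost number 3) -/
  | antiC (α : Multiset (Fin D)) (a : Fin D) : Var D

/-- Grassmann parity: the parity of pureghost number minus antighost number. -/
def Var.odd {D : ℕ} : Var D → Bool
  | .T _ _ _ _ => false
  | .S _ _ _ => true
  | .A _ _ _ => true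
  | .C _ _ => false
  | .antiT _ _ _ _ => true
  | .antiGhost _ _ _ => false
  | .antiC _ _ => true

/-- The sign `(-1)^{|u|}`. -/
def Var.sgn {D : ℕ} (u : Var D) : ℝ := if u.odd then -1 else 1

/-- The sign `(-1)^{|u||v|}`. -/
def koszul {D : ℕ} (u v : Var D) : ℝ := if u.odd && v.odd then -1 else 1

/-- The symbol as an element of the free associative algebra. -/
abbrev fr {D : ℕ} (u : Var D) : FreeAlgebra ℝ (Var D) := FreeAlgebra.ι ℝ u

/-- The relations: the index symmetries of the tensors, and graded commutativity. -/
inductive Rel (D : ℕ) : FreeAlgebra ℝ (Var D) → FreeAlgebra ℝ (Var D) → Prop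
  | T_antisymm (α : Multiset (Fin D)) (a b c : Fin D) :
      Rel D (fr (.T α a b c)) (-fr (.T α b a c))
  | T_cyclic (α : Multiset (Fin D)) (a b c : Fin D) :
      Rel D (fr (.T α a b c) + fr (.T α c a b) + fr (.T α b c a)) 0
  | S_symm (α : Multiset (Fin D)) (a b : Fin D) : Rel D (fr (.S α a b)) (fr (.S α b a))
  | A_antisymm (α : Multiset (Fin D)) (a b : Fin D) : Rel D (fr (.A α a b)) (-fr (.A α b a))
  | antiT_antisymm (α : Multiset (Fin D)) (a b c : Fin D) :
      Rel D (fr (.antiT α a b c)) (-fr (.antiT α b a c))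
  | antiT_cyclic (α : Multiset (Fin D)) (a b c : Fin D) :
      Rel D (fr (.antiT α a b c) + fr (.antiT α c a b) + fr (.antiT α b c a)) 0
  | supercomm (u v : Var D) : Rel D (fr u * fr v) (koszul u v • (fr v * fr u))

/-- The graded-commutative polynomial algebra generated by the fields, ghosts, ghosts of ghosts,
antifields and all their derivatives. -/
def Alg (D : ℕ) : Type := RingQuot (Rel D)

instance (D : ℕ) : Ring (Alg D) := inferInstanceAs (Ring (RingQuot (Rel D)))
instance (D : ℕ) : Algebra ℝ (Alg D) := inferInstanceAs (Algebra ℝ (RingQuot (Rel D)))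

/-- The quotient map from the free algebra. -/
def quot (D : ℕ) : FreeAlgebra ℝ (Var D) →ₐ[ℝ] Alg D := RingQuot.mkAlgHom ℝ (Rel D)

/-- The class of a symbol in the algebra. -/
def gen {D : ℕ} (u : Var D) : Alg D := quot D (fr u)

theorem quot_rel {D : ℕ} {x y : FreeAlgebra ℝ (Var D)} (h : Rel D x y) :
    quot D x = quot D y := RingQuot.mkAlgHom_rel ℝ h

/-- The universal property of the algebra. -/
def lift {D : ℕ} {B : Type} [Ring B] [Algebra ℝ B] (f : Var D → B)
    (hf : ∀ x y, Rel D x y → FreeAlgebra.lift ℝ f x = FreeAlgebra.lift ℝ f y) :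
    Alg D →ₐ[ℝ] B :=
  RingQuot.liftAlgHom ℝ ⟨FreeAlgebra.lift ℝ f, fun x y h => hf x y h⟩

theorem lift_gen {D : ℕ} {B : Type} [Ring B] [Algebra ℝ B] (f : Var D → B)
    (hf : ∀ x y, Rel D x y → FreeAlgebra.lift ℝ f x = FreeAlgebra.lift ℝ f y) (u : Var D) :
    lift f hf (gen u) = f u := by
  unfold lift gen quot
  exact (RingQuot.liftAlgHom_mkAlgHom_apply ℝ _ _ _).trans (FreeAlgebra.lift_ι_apply f u)

theorem alg_induction {D : ℕ} {p : Alg D → Prop} (hs : ∀ r : ℝ, p (algebraMap ℝ _ r))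
    (hg : ∀ u, p (gen u)) (hm : ∀ x y, p x → p y → p (x * y))
    (ha : ∀ x y, p x → p y → p (x + y)) (x : Alg D) : p x := by
  obtain ⟨y, rfl⟩ := RingQuot.mkAlgHom_surjective ℝ (Rel D) x
  change p (quot D y)
  induction y using FreeAlgebra.induction with
  | grade0 r => rw [AlgHom.commutes]; exact hs r
  | grade1 u => exact hg u
  | mul a b h1 h2 => rw [map_mul]; exact hm _ _ h1 h2
  | add a b h1 h2 => rw [map_add]; exact ha _ _ h1 h2

theorem gen_T_antisymm {D : ℕ} (α : Multiset (Fin D)) (a b c : Fin D) :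
    gen (.T α a b c) = -gen (.T α b a c) := by
  simpa [gen] using quot_rel (Rel.T_antisymm α a b c)

theorem gen_S_symm {D : ℕ} (α : Multiset (Fin D)) (a b : Fin D) :
    gen (.S α a b) = gen (.S α b a) := by
  simpa [gen] using quot_rel (Rel.S_symm α a b)

theorem gen_A_antisymm {D : ℕ} (α : Multiset (Fin D)) (a b : Fin D) :
    gen (.A α a b) = -gen (.A α b a) := by
  simpa [gen] using quot_rel (Rel.A_antisymm α a b)

theorem gen_supercomm {D : ℕ} (u v : Var D) :
    gen u * gen v = koszul u v • (gen v * gen u) := by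
  simpa [gen] using quot_rel (Rel.supercomm u v)

/-- The action of the longitudinal exterior derivative on the generators. -/
def gammaVar {D : ℕ} : Var D → Alg D
  | .T α a b c =>
      gen (.S (a ::ₘ α) b c) - gen (.S (b ::ₘ α) a c)
        + gen (.A (a ::ₘ α) b c) - gen (.A (b ::ₘ α) a c) - (2 : ℝ) • gen (.A (c ::ₘ α) a b)
  | .S α a b => (3 : ℝ) • (gen (.C (a ::ₘ α) b) + gen (.C (b ::ₘ α) a))
  | .A α a b => gen (.C (a ::ₘ α) b) - gen (.C (b ::ₘ α) a)
  | .C _ _ => 0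
  | .antiT _ _ _ _ => 0
  | .antiGhost _ _ _ => 0
  | .antiC _ _ => 0

theorem gammaVar_supercomm {D : ℕ} (u v : Var D) :
    gammaVar v * gen u = (u.sgn * koszul u v) • (gen u * gammaVar v) := by
  cases v with
  | T α a b c =>
    simp only [gammaVar, sub_mul, add_mul, mul_sub, mul_add, smul_mul_assoc, mul_smul_comm]
    rw [gen_supercomm (.S (a ::ₘ α) b c) u, gen_supercomm (.S (b ::ₘ α) a c) u,
      gen_supercomm (.A (a ::ₘ α) b c) u, gen_supercomm (.A (b ::ₘ α) a c) u,
      gen_supercomm (.A (c ::ₘ α) a b) u]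
    cases u <;> simp [koszul, Var.sgn, Var.odd] <;> abel
  | S α a b =>
    simp only [gammaVar, add_mul, mul_add, smul_mul_assoc, mul_smul_comm]
    rw [gen_supercomm (.C (a ::ₘ α) b) u, gen_supercomm (.C (b ::ₘ α) a) u]
    cases u <;> simp [koszul, Var.sgn, Var.odd]
  | A α a b =>
    simp only [gammaVar, sub_mul, mul_sub]
    rw [gen_supercomm (.C (a ::ₘ α) b) u, gen_supercomm (.C (b ::ₘ α) a) u]
    cases u <;> simp [koszul, Var.sgn, Var.odd]
  | C α a => simp [gammaVar]
  | antiT α a b c => simp [gammaVar]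
  | antiGhost α a b => simp [gammaVar]
  | antiC α a => simp [gammaVar]

/-- An algebra morphism `x ↦ (σ x, γ x; 0, x)` into `2 × 2` matrices, with `σ` the parity
automorphism, is the same thing as an antiderivation `γ`. Here is its value on generators. -/
def gammaMatVar {D : ℕ} (u : Var D) : Matrix (Fin 2) (Fin 2) (Alg D) :=
  !![u.sgn • gen u, gammaVar u; 0, gen u]

theorem gammaMatVar_rel {D : ℕ} (x y : FreeAlgebra ℝ (Var D)) (h : Rel D x y) :
    FreeAlgebra.lift ℝ (gammaMatVar (D := D)) x = FreeAlgebra.lift ℝ gammaMatVar y := by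
  have key := quot_rel h
  cases h with
  | T_antisymm α a b c =>
    simp only [fr, map_neg, FreeAlgebra.lift_ι_apply] at key ⊢
    change gen _ = - gen _ at key
    ext i j
    fin_cases i <;> fin_cases j <;> simp [gammaMatVar, Var.sgn, Var.odd, key]
    simp only [gammaVar]
    rw [gen_A_antisymm (c ::ₘ α) b a]
    simp only [smul_neg]
    abel
  | T_cyclic α a b c =>
    simp only [fr, map_add, map_zero, FreeAlgebra.lift_ι_apply] at key ⊢
    change gen _ + gen _ + gen _ = 0 at key
    ext i j
    fin_cases i <;> fin_cases j <;> simp [gammaMatVar, Var.sgn, Var.odd, key]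
    simp only [gammaVar]
    rw [gen_S_symm (a ::ₘ α) c b, gen_S_symm (b ::ₘ α) c a, gen_S_symm (c ::ₘ α) b a,
      gen_A_antisymm (a ::ₘ α) c b, gen_A_antisymm (b ::ₘ α) c a, gen_A_antisymm (c ::ₘ α) b a]
    simp only [two_smul]
    abel
  | S_symm α a b =>
    simp only [fr, FreeAlgebra.lift_ι_apply] at key ⊢
    change gen _ = gen _ at key
    ext i j
    fin_cases i <;> fin_cases j <;> simp [gammaMatVar, Var.sgn, Var.odd, key]
    simp only [gammaVar, add_comm]
  | A_antisymm α a b =>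
    simp only [fr, map_neg, FreeAlgebra.lift_ι_apply] at key ⊢
    change gen _ = - gen _ at key
    ext i j
    fin_cases i <;> fin_cases j <;> simp [gammaMatVar, Var.sgn, Var.odd, key]
    simp only [gammaVar]
    abel
  | antiT_antisymm α a b c =>
    simp only [fr, map_neg, FreeAlgebra.lift_ι_apply] at key ⊢
    change gen _ = - gen _ at key
    ext i j
    fin_cases i <;> fin_cases j <;> simp [gammaMatVar, Var.sgn, Var.odd, key, gammaVar]
  | antiT_cyclic α a b c =>
    simp only [fr, map_add, map_zero, FreeAlgebra.lift_ι_apply] at key ⊢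
    change gen _ + gen _ + gen _ = 0 at key
    ext i j
    fin_cases i <;> fin_cases j <;> simp [gammaMatVar, Var.sgn, Var.odd, gammaVar, key]
    rw [← neg_add, ← neg_add, key, neg_zero]
  | supercomm u v =>
    clear key
    simp only [map_mul, map_smul, FreeAlgebra.lift_ι_apply]
    have h1 := gen_supercomm u v
    have h2 := gammaVar_supercomm u v
    have h3 := gammaVar_supercomm v u
    ext i j
    fin_cases i <;> fin_cases j <;> simp [gammaMatVar, Matrix.mul_apply, Fin.sum_univ_two]
    · rw [h1, smul_smul, smul_smul, smul_smul, smul_smul]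
      congr 1; ring
    · rw [h2, h3, add_comm]
      cases hu : u.odd <;> cases hv : v.odd <;> simp [koszul, Var.sgn, hu, hv]
    · exact h1

/-- The algebra morphism `x ↦ (σ x, γ x; 0, x)`. -/
def gammaMat (D : ℕ) : Alg D →ₐ[ℝ] Matrix (Fin 2) (Fin 2) (Alg D) :=
  lift gammaMatVar gammaMatVar_rel

/-- The longitudinal exterior derivative. -/
def gamma (D : ℕ) : Alg D →ₗ[ℝ] Alg D :=
  (LinearMap.proj 1 ∘ₗ LinearMap.proj 0) ∘ₗ (gammaMat D).toLinearMap

/-- The parity automorphism `x ↦ (-1)^{|x|} x`. -/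
def parity (D : ℕ) : Alg D →ₗ[ℝ] Alg D :=
  (LinearMap.proj 0 ∘ₗ LinearMap.proj 0) ∘ₗ (gammaMat D).toLinearMap

theorem gamma_apply {D : ℕ} (x : Alg D) : gamma D x = gammaMat D x 0 1 := rfl

theorem parity_apply {D : ℕ} (x : Alg D) : parity D x = gammaMat D x 0 0 := rfl

theorem gamma_gen {D : ℕ} (u : Var D) : gamma D (gen u) = gammaVar u := by
  rw [gamma_apply, gammaMat, lift_gen]; simp [gammaMatVar]

theorem parity_gen {D : ℕ} (u : Var D) : parity D (gen u) = u.sgn • gen u := by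
  rw [parity_apply, gammaMat, lift_gen]; simp [gammaMatVar]

theorem gammaMat_lower {D : ℕ} (x : Alg D) : gammaMat D x 1 0 = 0 ∧ gammaMat D x 1 1 = x := by
  induction x using alg_induction with
  | hs r => simp [Matrix.algebraMap_matrix_apply]
  | hg u => rw [gammaMat, lift_gen]; simp [gammaMatVar]
  | hm x y hx hy => simp [Matrix.mul_apply, Fin.sum_univ_two, hx, hy]
  | ha x y hx hy => simp [hx, hy]

theorem parity_mul {D : ℕ} (x y : Alg D) : parity D (x * y) = parity D x * parity D y := by
  simp [parity_apply, Matrix.mul_apply, Fin.sum_univ_two, gammaMat_lower]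

theorem parity_algebraMap {D : ℕ} (r : ℝ) :
    parity D (algebraMap ℝ (Alg D) r) = algebraMap ℝ (Alg D) r := by
  simp [parity_apply, Matrix.algebraMap_matrix_apply]

theorem gamma_algebraMap {D : ℕ} (r : ℝ) : gamma D (algebraMap ℝ (Alg D) r) = 0 := by
  simp [gamma_apply, Matrix.algebraMap_matrix_apply]

/-- The graded Leibniz rule. -/
theorem gamma_mul {D : ℕ} (x y : Alg D) :
    gamma D (x * y) = gamma D x * y + parity D x * gamma D y := by
  simp [gamma_apply, parity_apply, Matrix.mul_apply, Fin.sum_univ_two, gammaMat_lower, add_comm]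

theorem parity_gamma {D : ℕ} (x : Alg D) : parity D (gamma D x) = -gamma D (parity D x) := by
  induction x using alg_induction with
  | hs r => simp [gamma_algebraMap, parity_algebraMap]
  | hg u =>
    rw [gamma_gen, parity_gen, map_smul, gamma_gen]
    cases u <;> simp [gammaVar, parity_gen, Var.sgn, Var.odd] <;> abel
  | hm x y hx hy => simp [gamma_mul, parity_mul, hx, hy]; abel
  | ha x y hx hy => simp [hx, hy]; abel

/-- The longitudinal exterior derivative is a differential. -/
theorem gamma_gamma {D : ℕ} (x : Alg D) : gamma D (gamma D x) = 0 := by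
  induction x using alg_induction with
  | hs r => simp [gamma_algebraMap]
  | hg u =>
    rw [gamma_gen]
    cases u with
    | T α a b c =>
      simp only [gammaVar, map_sub, map_add, map_smul, gamma_gen]
      rw [Multiset.cons_swap b a α, Multiset.cons_swap c a α, Multiset.cons_swap c b α]
      module
    | _ => simp [gammaVar, gamma_gen]
  | hm x y hx hy => simp [gamma_mul, hx, hy, parity_gamma]
  | ha x y hx hy => simp [hx, hy]

/-- `Ker γ`. -/
abbrev cocycles (D : ℕ) : Submodule ℝ (Alg D) := LinearMap.ker (gamma D)

/-- `Im γ`. -/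
abbrev coboundaries (D : ℕ) : Submodule ℝ (Alg D) := LinearMap.range (gamma D)

/-- `H(γ) = Ker γ / Im γ`. -/
abbrev Cohomology (D : ℕ) : Type := cocycles D ⧸ (coboundaries D).submoduleOf (cocycles D)

/-! ### Young projections -/

section Young

variable {P : Type} [Fintype P] [DecidableEq P] {I M : Type} [AddCommGroup M] [Module ℝ M]

/-- The permutations of the set `P` of index places that preserve every line (fibre of `line`). -/
def linePerms (line : P → ℕ) : Finset (Equiv.Perm P) :=
  Finset.univ.filter fun π => ∀ p, line (π p) = line p

/-- Normalized symmetrization of a tensor over each line. -/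
def symmetrize (line : P → ℕ) (X : (P → I) → M) (i : P → I) : M :=
  ((linePerms line).card : ℝ)⁻¹ • ∑ π ∈ linePerms line, X (i ∘ π)

/-- Normalized antisymmetrization of a tensor over each line. -/
def antisymmetrize (line : P → ℕ) (X : (P → I) → M) (i : P → I) : M :=
  ((linePerms line).card : ℝ)⁻¹ •
    ∑ π ∈ linePerms line, ((Equiv.Perm.sign π : ℤ) : ℝ) • X (i ∘ π)

end Young

/-- The index places of `∂_{d₁ … d_{m+2}} T_{[ab]c}`: the places of `a`, `b`, `c` and those of
`d₁, …, d_{m+2}`. -/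
abbrev Place (m : ℕ) : Type := Fin 3 ⊕ Fin (m + 2)

/-- Row (from 0) of an index place in the Young tableau whose rows are
`a c d₁ … d_m`, `b d_{m+1}` and `d_{m+2}`. -/
def rowE (m : ℕ) : Place m → ℕ :=
  Sum.elim ![0, 1, 0] fun j => if (j : ℕ) < m then 0 else if (j : ℕ) = m then 1 else 2

/-- Column (from 0) of an index place in the same tableau. -/
def colE (m : ℕ) : Place m → ℕ :=
  Sum.elim ![0, 0, 1] fun j => if (j : ℕ) < m then j + 2 else if (j : ℕ) = m then 1 else 0

/-- The tensor `∂_{d₁ … d_{m+2}} T_{[ab]c}` as a function of its indices. -/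
def derivT {D : ℕ} (m : ℕ) (i : Place m → Fin D) : Alg D :=
  gen (.T (Finset.univ.val.map fun j => i (Sum.inr j))
    (i (Sum.inl 0)) (i (Sum.inl 1)) (i (Sum.inl 2)))

/-- The components `E^T_{abc d₁ … d_k}`, `k = m + 2`: symmetrize over the rows of the tableau,
then antisymmetrize over its columns. -/
def ET {D : ℕ} (m : ℕ) (i : Place m → Fin D) : Alg D :=
  antisymmetrize (colE m) (symmetrize (rowE m) (derivT m)) i

/-- `F^A_{abc}`, the totally antisymmetric part of `∂_c A_{ab}`. -/
def FA {D : ℕ} (i : Fin 3 → Fin D) : Alg D :=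
  antisymmetrize (fun _ => 0) (fun j : Fin 3 → Fin D => gen (.A {j 2} (j 0) (j 1))) i

/-- `∂_α F_{[abc]d}`, with
`F_{[abc]d} = ∂_a T_{[bc]d} + ∂_b T_{[ca]d} + ∂_c T_{[ab]d}` the field strength. -/
def fieldStrength {D : ℕ} (α : Multiset (Fin D)) (a b c d : Fin D) : Alg D :=
  gen (.T (a ::ₘ α) b c d) + gen (.T (b ::ₘ α) c a d) + gen (.T (c ::ₘ α) a b d)

/-- `∂_α (∂_d F_{[abc]e} - ∂_e F_{[abc]d})`, the derivatives of the curl of the field strength. -/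
def curlF {D : ℕ} (α : Multiset (Fin D)) (a b c d e : Fin D) : Alg D :=
  fieldStrength (d ::ₘ α) a b c e - fieldStrength (e ::ₘ α) a b c d

/-- The set of all components `E^T`. -/
def setE (D : ℕ) : Set (Alg D) := {x | ∃ (m : ℕ) (i : Place m → Fin D), x = ET m i}

/-- The set of all antifields and their derivatives. -/
def setAntifields (D : ℕ) : Set (Alg D) :=
  {x | (∃ α a b c, x = gen (.antiT α a b c)) ∨ (∃ α a b, x = gen (.antiGhost α a b)) ∨
    ∃ α a, x = gen (.antiC α a)}

/-- The subalgebra generated by the undifferentiated `C_a`, the `F^A_{abc}`, the `E^T`, the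
antifields and the derivatives of the antifields. -/
def invariantAlg (D : ℕ) : Subalgebra ℝ (Alg D) :=
  Algebra.adjoin ℝ ((Set.range fun a : Fin D => gen (.C 0 a)) ∪ Set.range FA ∪ setE D ∪
    setAntifields D)

/-- The polynomials in the derivatives `∂_α T_{[ab]c}` whose order `|α|` satisfies `p`. -/
def fieldAlgOrder (D : ℕ) (p : ℕ → Prop) : Subalgebra ℝ (Alg D) :=
  Algebra.adjoin ℝ {x | ∃ α a b c, p (Multiset.card α) ∧ x = gen (.T α a b c)}

/-- The local functions of the fields: polynomials in `T` and its derivatives of any order. -/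
def fieldAlg (D : ℕ) : Subalgebra ℝ (Alg D) := fieldAlgOrder D fun _ => True

/-! ### Gauge transformations -/

/-- The jet at a point of a field `T_{[ab]c}`: the values of all its derivatives there. -/
structure FieldJet (D : ℕ) where
  val : Multiset (Fin D) → Fin D → Fin D → Fin D → ℝ
  antisymm : ∀ α a b c, val α a b c = -val α b a c
  cyclic : ∀ α a b c, val α a b c + val α c a b + val α b c a = 0

/-- The jet at a point of a symmetric gauge parameter `ε_{ab}`. -/
structure SymmJet (D : ℕ) where
  val : Multiset (Fin D) → Fin D → Fin D → ℝ
  symm : ∀ α a b, val α a b = val α b a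

/-- The jet at a point of an antisymmetric gauge parameter `η_{ab}`. -/
structure AntisymmJet (D : ℕ) where
  val : Multiset (Fin D) → Fin D → Fin D → ℝ
  antisymm : ∀ α a b, val α a b = -val α b a

/-- The jet of the gauge transformed field
`T_{[ab]c} + ∂_a ε_{bc} - ∂_b ε_{ac} + ∂_a η_{bc} - ∂_b η_{ac} - 2 ∂_c η_{ab}`. -/
def FieldJet.transform {D : ℕ} (t : FieldJet D) (e : SymmJet D) (h : AntisymmJet D) :
    FieldJet D where
  val α a b c := t.val α a b c + (e.val (a ::ₘ α) b c - e.val (b ::ₘ α) a c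
    + h.val (a ::ₘ α) b c - h.val (b ::ₘ α) a c - 2 * h.val (c ::ₘ α) a b)
  antisymm α a b c := by
    have := t.antisymm α a b c
    have := h.antisymm (c ::ₘ α) a b
    linarith
  cyclic α a b c := by
    have := t.cyclic α a b c
    have := e.symm (a ::ₘ α) b c
    have := e.symm (b ::ₘ α) c a
    have := e.symm (c ::ₘ α) a b
    have := h.antisymm (a ::ₘ α) b c
    have := h.antisymm (b ::ₘ α) c a
    have := h.antisymm (c ::ₘ α) a b
    linarith

/-- The value of a generator on a field jet; ghosts and antifields are put to zero. -/
def FieldJet.evalVar {D : ℕ} (t : FieldJet D) : Var D → ℝ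
  | .T α a b c => t.val α a b c
  | _ => 0

/-- Evaluation on a field jet; on the local functions of the fields it substitutes the values of
`T` and of its derivatives. -/
def FieldJet.eval {D : ℕ} (t : FieldJet D) : Alg D →ₐ[ℝ] ℝ :=
  lift t.evalVar (by
    intro x y h
    cases h with
    | T_antisymm α a b c => simpa [FieldJet.evalVar] using t.antisymm α a b c
    | T_cyclic α a b c => simpa [FieldJet.evalVar] using t.cyclic α a b c
    | S_symm α a b => simp [FieldJet.evalVar]
    | A_antisymm α a b => simp [FieldJet.evalVar]
    | antiT_antisymm α a b c => simp [FieldJet.evalVar]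
    | antiT_cyclic α a b c => simp [FieldJet.evalVar]
    | supercomm u v =>
      cases u <;> cases v <;> simp [FieldJet.evalVar, koszul, Var.odd, mul_comm])

/-- A local function of the fields is strictly gauge invariant if its value on every field is
unchanged by every gauge transformation. -/
def GaugeInvariant {D : ℕ} (f : Alg D) : Prop :=
  ∀ (t : FieldJet D) (e : SymmJet D) (h : AntisymmJet D), (t.transform e h).eval f = t.eval f

end MixedGauge

end

/-! The proof builds an antiderivation `h` with h² = 0 on the fields' image not needed, only this: N
= γh + hγ is an even derivation commuting with γ, it kills the invariant algebra 𝓑, and modulo the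
linear span of the generators of 𝓑 it is the identity on every symbol. Hence 𝒜 = 𝓑 + 𝒫, with 𝒫 the
sum of the eigenspaces of N for positive integers. On 𝒫 the operator N is invertible and a cocycle y
= Nz is exact, while 𝓑 consists of cocycles and meets 𝒫 only in zero. This gives both halves of part
(1): every cocycle is cohomologous to an element of 𝓑, and no nonzero element of 𝓑 is exact.

So everything reduces to the linear complex ∂…T → ∂…S, ∂…A → ∂…C. Its cohomology is computed by the
algebraic Poincaré lemma, applied to jets with values in a quotient space so that it yields linear
maps. At T, a field with vanishing curl of its field strength is pure gauge
(`exists_gauge_of_curl_eq_zero`), so the kernel of γ is spanned by the curls. At the ghosts, the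
only classes are the F^A (`exists_of_gamma_eq_zero`). At C, every differentiated symbol is exact and
only the undifferentiated C_a survive (`exists_homotopy_C`). `exists_isHomotopy` assembles the three
partial inverses into `h`.

Part (2) is a computation with the Young symmetrizer. After column antisymmetrization, each row
permutation multiplies the antisymmetrized ∂…T by 1, 1/2 or 0. There is thus no cancellation, and
E^T is a nonzero multiple of the column antisymmetrization, which is one sixth of the curl
(`exists_ET_eq_smul_colT`, `curlPlace_eq`).

For part (3), `h` vanishes on polynomials in the fields, so such a cocycle has no component in 𝒫 and
is a polynomial in the E^T. Conversely `h` supplies a field-dependent gauge transformation that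
takes T to a combination of curls, and an invariant function does not notice it
(`mem_adjoin_of_gaugeInvariant`). Polynomials are recovered from their values on jets by
`eq_zero_of_eval_eq_zero`. -/

noncomputable section

namespace MixedGauge

/-! ### The Poincaré lemma for jets -/

section Jets

variable {I Q : Type} [DecidableEq I] [AddCommGroup Q]

/-- Contraction of the form index of a jet with the position vector. -/
def contr (g : I → Multiset I → Q) (α : Multiset I) : Q :=
  (α.map fun d => g d (α.erase d)).sum

/-- Leibniz rule: ∂_a (x^d g_d) = g_a + x^d ∂_a g_d, where `contr g` is the jet at the origin of x^d
g_d. -/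
theorem contr_cons (g : I → Multiset I → Q) (a : I) (α : Multiset I) :
    contr g (a ::ₘ α) = g a α + contr (fun d β => g d (a ::ₘ β)) α := by
  unfold contr
  rw [Multiset.map_cons, Multiset.sum_cons, Multiset.erase_cons_head]
  congr 2
  refine Multiset.map_congr rfl fun d hd => ?_
  by_cases h : d = a
  · subst h; simp [Multiset.cons_erase hd]
  · rw [Multiset.erase_cons_tail _ (Ne.symm h)]

theorem contr_add (f g : I → Multiset I → Q) (α : Multiset I) :
    contr f α + contr g α = contr (fun d β => f d β + g d β) α := by
  simp [contr, Multiset.sum_map_add]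

theorem contr_neg (f : I → Multiset I → Q) (α : Multiset I) :
    -contr f α = contr (fun d β => -f d β) α := by
  simp [contr]

theorem contr_sub (f g : I → Multiset I → Q) (α : Multiset I) :
    contr f α - contr g α = contr (fun d β => f d β - g d β) α := by
  simp [contr]

variable [Module ℝ Q]

/-- Euler's identity: x^d ∂_d multiplies the Taylor coefficients of order k by k. -/
theorem contr_self (f : Multiset I → Q) (α : Multiset I) :
    contr (fun d β => f (d ::ₘ β)) α = (Multiset.card α : ℝ) • f α := by
  have h : α.map (fun d => f (d ::ₘ α.erase d)) = α.map fun _ => f α :=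
    Multiset.map_congr rfl fun d hd => by rw [Multiset.cons_erase hd]
  rw [contr, h, Multiset.map_const', Multiset.sum_replicate, Nat.cast_smul_eq_nsmul]

theorem poincare_one (f : I → Multiset I → Q)
    (hf : ∀ α a b, f a (b ::ₘ α) = f b (a ::ₘ α)) (a : I) (α : Multiset I) :
    (Multiset.card (a ::ₘ α) : ℝ)⁻¹ • contr f (a ::ₘ α) = f a α := by
  have h : contr f (a ::ₘ α) = (Multiset.card (a ::ₘ α) : ℝ) • f a α := by
    rw [contr_cons]
    simp only [fun d β => hf β d a, contr_self, Multiset.card_cons]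
    push_cast
    module
  rw [h, inv_smul_smul₀]
  rw [Multiset.card_cons]
  positivity

/-- The potential is the radial contraction of the form. For a closed p-form, Cartan's formula
rescales by the order of differentiation plus p, which is the order of the potential's jet plus p -
1; hence the denominators |α|, |α| + 1 and |α| + 2 in the three lemmas. -/
theorem poincare_two (f : Multiset I → I → I → Q) (anti : ∀ α a b, f α a b = -f α b a)
    (closed : ∀ α a b c, f (a ::ₘ α) b c + f (b ::ₘ α) c a + f (c ::ₘ α) a b = 0) :
    ∃ g : Multiset I → I → Q, ∀ α a b, f α a b = g (a ::ₘ α) b - g (b ::ₘ α) a := by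
  refine ⟨fun α b => ((Multiset.card α : ℝ) + 1)⁻¹ • contr (fun d β => f β d b) α,
    fun α a b => ?_⟩
  simp only [Multiset.card_cons]
  rw [← smul_sub, contr_cons, contr_cons]
  have h : contr (fun d β => f (a ::ₘ β) d b) α - contr (fun d β => f (b ::ₘ β) d a) α
      = (Multiset.card α : ℝ) • f α a b := by
    rw [contr_sub, ← contr_self (fun β => f β a b)]
    congr 1
    funext d β
    rw [anti (a ::ₘ β) d b]
    linear_combination (norm := module) - closed β a b d
  have h2 : f α a b + contr (fun d β => f (a ::ₘ β) d b) α -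
      (f α b a + contr (fun d β => f (b ::ₘ β) d a) α)
      = (((Multiset.card α + 1 : ℕ) : ℝ) + 1) • f α a b := by
    push_cast
    linear_combination (norm := module) h - anti α b a
  rw [h2, inv_smul_smul₀ (by positivity)]

theorem poincare_three (f : Multiset I → I → I → I → Q)
    (anti : ∀ α a b c, f α a b c = -f α b a c) (cyc : ∀ α a b c, f α a b c = f α b c a)
    (closed : ∀ α a b c d,
      f (d ::ₘ α) a b c - f (a ::ₘ α) b c d + f (b ::ₘ α) c d a - f (c ::ₘ α) d a b = 0) :
    ∃ g : Multiset I → I → I → Q, (∀ α a b, g α a b = -g α b a) ∧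
      ∀ α a b c, f α a b c = g (a ::ₘ α) b c + g (b ::ₘ α) c a + g (c ::ₘ α) a b := by
  refine ⟨fun α b c => ((Multiset.card α : ℝ) + 2)⁻¹ • contr (fun d β => f β d b c) α,
    fun α a b => ?_, fun α a b c => ?_⟩
  · dsimp only
    rw [← smul_neg, contr_neg]
    congr 2
    funext d β
    rw [cyc β d a b, cyc β d b a, cyc β b a d, anti β a b d, cyc β b a d]
  · simp only [Multiset.card_cons]
    rw [← smul_add, ← smul_add, contr_cons, contr_cons, contr_cons]
    have h : contr (fun d β => f (a ::ₘ β) d b c) α + contr (fun d β => f (b ::ₘ β) d c a) α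
        + contr (fun d β => f (c ::ₘ β) d a b) α = (Multiset.card α : ℝ) • f α a b c := by
      rw [contr_add, contr_add, ← contr_self (fun β => f β a b c)]
      congr 1
      funext d β
      have h1 := closed β a b c d
      rw [← cyc (a ::ₘ β) d b c, cyc (b ::ₘ β) c d a, anti (b ::ₘ β) d a c,
        cyc (b ::ₘ β) a d c] at h1
      linear_combination (norm := module) - h1
    have h2 : f α a b c + contr (fun d β => f (a ::ₘ β) d b c) α +
        (f α b c a + contr (fun d β => f (b ::ₘ β) d c a) α) +
        (f α c a b + contr (fun d β => f (c ::ₘ β) d a b) α)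
        = (((Multiset.card α + 1 : ℕ) : ℝ) + 2) • f α a b c := by
      push_cast
      linear_combination (norm := module) h - 2 • cyc α a b c - cyc α b c a
    rw [h2, inv_smul_smul₀ (by positivity)]

/-- A jet of the mixed symmetry field whose curvature vanishes is pure gauge. -/
theorem exists_gauge_of_curl_eq_zero (T : Multiset I → I → I → I → Q)
    (anti : ∀ α a b c, T α a b c = -T α b a c)
    (cyc : ∀ α a b c, T α a b c + T α c a b + T α b c a = 0)
    (curl : ∀ α a b c d e,
      T (a ::ₘ d ::ₘ α) b c e + T (b ::ₘ d ::ₘ α) c a e + T (c ::ₘ d ::ₘ α) a b e =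
      T (a ::ₘ e ::ₘ α) b c d + T (b ::ₘ e ::ₘ α) c a d + T (c ::ₘ e ::ₘ α) a b d) :
    ∃ s h : Multiset I → I → I → Q, (∀ α a b, s α a b = s α b a) ∧
      (∀ α a b, h α a b = -h α b a) ∧
      ∀ α a b c, T α a b c = s (a ::ₘ α) b c - s (b ::ₘ α) a c
        + h (a ::ₘ α) b c - h (b ::ₘ α) a c - (2 : ℝ) • h (c ::ₘ α) a b := by
  let F : I → I → I → I → Multiset I → Q := fun a b c e α =>
    T (a ::ₘ α) b c e + T (b ::ₘ α) c a e + T (c ::ₘ α) a b e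
  -- `curl` says that F_{abc|e} is closed in e, so F_{abc|e} = ∂_e X_{abc}. The undetermined
  -- constant X at order zero gets the value 0, since both factors vanish there.
  let X : Multiset I → I → I → I → Q := fun α a b c =>
    (Multiset.card α : ℝ)⁻¹ • contr (F a b c) α
  have hX : ∀ α a b c e, X (e ::ₘ α) a b c = F a b c e α := fun α a b c e =>
    poincare_one (F a b c) (fun β d e => curl β a b c e d) e α
  -- The cyclic identity kills the totally antisymmetric part of F_{abc|d}, so X is a closed 3-form
  -- and X = dY.
  obtain ⟨Y, Yanti, hY⟩ := poincare_three X
    (fun α a b c => by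
      simp only [X]
      rw [← smul_neg, contr_neg]
      congr 2
      funext d β
      simp only [F]
      linear_combination (norm := module) anti (a ::ₘ β) b c d + anti (b ::ₘ β) c a d +
        anti (c ::ₘ β) a b d)
    (fun α a b c => by
      simp only [X]
      congr 2
      funext d β
      simp only [F]
      abel)
    (fun α a b c d => by
      simp only [hX, F]
      linear_combination (norm := module) cyc (a ::ₘ α) b c d - cyc (b ::ₘ α) c d a
        + cyc (c ::ₘ α) d a b - cyc (d ::ₘ α) a b c - anti (a ::ₘ α) b d c
        + anti (b ::ₘ α) c a d - anti (c ::ₘ α) d b a + anti (d ::ₘ α) a c b)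
  -- For fixed c the 2-form T_{ab|c} - ∂_c Y_{ab} is closed, because dT_{·|c} = ∂_c X = ∂_c dY.
  have hZ : ∀ c, ∃ Z : Multiset I → I → Q,
      ∀ α a b, T α a b c - Y (c ::ₘ α) a b = Z (a ::ₘ α) b - Z (b ::ₘ α) a := fun c =>
    poincare_two (fun α a b => T α a b c - Y (c ::ₘ α) a b)
      (fun α a b => by
        linear_combination (norm := module) anti α a b c - Yanti (c ::ₘ α) a b)
      (fun α a b d => by
        have h := hY (c ::ₘ α) a b d
        rw [hX] at h
        simp only [F] at h
        rw [Multiset.cons_swap c a, Multiset.cons_swap c b, Multiset.cons_swap c d]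
        linear_combination (norm := module) h)
  choose Z hZ using hZ
  -- Summing the previous identity cyclically and using the cyclic identity for T leaves d(Y_{ab} +
  -- Z_{b|a} - Z_{a|b}) = 0.
  obtain ⟨W, hW⟩ := poincare_two (fun α a b => Y α a b + Z b α a - Z a α b)
    (fun α a b => by linear_combination (norm := module) Yanti α a b)
    (fun α a b c => by
      have h1 := hZ c α a b
      have h2 := hZ b α c a
      have h3 := hZ a α b c
      linear_combination (norm := module) cyc α a b c - h1 - h2 - h3)
  -- The gauge variation depends only on N = s + h, as ∂_a N_{bc} - ∂_b N_{ac} - ∂_c (N_{ab} -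
  -- N_{ba}). W enters once through the first two terms and once through the last, hence the factor
  -- 1/2.
  let N : Multiset I → I → I → Q := fun α b c => Z c α b + (2⁻¹ : ℝ) • W (c ::ₘ α) b
  refine ⟨fun α a b => (2⁻¹ : ℝ) • (N α a b + N α b a),
    fun α a b => (2⁻¹ : ℝ) • (N α a b - N α b a), fun α a b => by module,
    fun α a b => by module, fun α a b c => ?_⟩
  have h1 := hZ c α a b
  have h2 := hW (c ::ₘ α) a b
  simp only [N]
  rw [Multiset.cons_swap b a α, Multiset.cons_swap c a α, Multiset.cons_swap c b α] at *
  linear_combination (norm := module) h1 + h2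

end Jets

/-! ### Young symmetrizers -/

section Young

variable {P : Type} [Fintype P] [DecidableEq P] {I M : Type} [AddCommGroup M] [Module ℝ M]

theorem mem_linePerms {line : P → ℕ} {π : Equiv.Perm P} :
    π ∈ linePerms line ↔ ∀ p, line (π p) = line p := by
  simp [linePerms]

theorem one_mem_linePerms (line : P → ℕ) : 1 ∈ linePerms line := by
  simp [linePerms]

theorem card_linePerms_pos (line : P → ℕ) : (0 : ℝ) < (linePerms line).card := by
  exact_mod_cast Finset.card_pos.mpr ⟨1, one_mem_linePerms line⟩

theorem swap_mem_linePerms {line : P → ℕ} {p q : P} (h : line p = line q) :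
    Equiv.swap p q ∈ linePerms line := by
  rw [mem_linePerms]
  intro x
  rw [Equiv.swap_apply_def]
  split_ifs <;> simp_all

/-- Reindex the sum by π ↦ πτ and use that the sign is multiplicative. -/
theorem antisymmetrize_comp_perm {line : P → ℕ} {τ : Equiv.Perm P} (hτ : τ ∈ linePerms line)
    (X : (P → I) → M) (i : P → I) :
    antisymmetrize line (fun j => X (j ∘ τ)) i =
      ((Equiv.Perm.sign τ : ℤ) : ℝ) • antisymmetrize line X i := by
  unfold antisymmetrize
  rw [smul_comm (((Equiv.Perm.sign τ : ℤ) : ℝ))]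
  congr 1
  rw [Finset.smul_sum]
  refine Finset.sum_equiv (Equiv.mulRight τ) (fun π => ?_) (fun π _ => ?_)
  · simp only [mem_linePerms, Equiv.coe_mulRight, Equiv.Perm.mul_apply] at hτ ⊢
    refine ⟨fun h p => (h _).trans (hτ p), fun h p => ?_⟩
    have h1 := h (τ⁻¹ p)
    have h2 := hτ (τ⁻¹ p)
    simp only [Equiv.Perm.inv_def, Equiv.apply_symm_apply] at h1 h2
    exact h1.trans h2.symm
  · have h1 : (i ∘ π) ∘ τ = i ∘ ⇑(π * τ) := rfl
    simp only [Equiv.coe_mulRight, smul_smul, Equiv.Perm.sign_mul, h1]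
    congr 1
    rcases Int.units_eq_one_or (Equiv.Perm.sign τ) with h | h <;> simp [h]

theorem antisymmetrize_swap {line : P → ℕ} {p q : P} (hpq : p ≠ q) (h : line p = line q)
    (X : (P → I) → M) (i : P → I) :
    antisymmetrize line (fun j => X (j ∘ Equiv.swap p q)) i = -antisymmetrize line X i := by
  rw [antisymmetrize_comp_perm (swap_mem_linePerms h), Equiv.Perm.sign_swap hpq]
  simp

theorem antisymmetrize_eq_zero {line : P → ℕ} {p q : P} (hpq : p ≠ q) (h : line p = line q)
    (X : (P → I) → M) (hX : ∀ j, X (j ∘ Equiv.swap p q) = X j) (i : P → I) :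
    antisymmetrize line X i = 0 := by
  have h1 := antisymmetrize_swap hpq h X i
  simp only [hX] at h1
  have h2 : (2 : ℝ) • antisymmetrize line X i = 0 := by
    rw [two_smul]
    exact eq_neg_iff_add_eq_zero.mp h1
  exact (smul_eq_zero_iff_right two_ne_zero).mp h2

/-- Line-preserving permutations are products of line-preserving transpositions: swapping x with π x
fixes one more point, so induction on the size of the support applies. -/
theorem comp_linePerm_of_antisymm {line : P → ℕ} {Y : (P → I) → M}
    (hY : ∀ p q, p ≠ q → line p = line q → ∀ i, Y (i ∘ Equiv.swap p q) = -Y i)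
    (π : Equiv.Perm P) (hπ : π ∈ linePerms line) (i : P → I) :
    Y (i ∘ π) = ((Equiv.Perm.sign π : ℤ) : ℝ) • Y i := by
  induction hn : π.support.card using Nat.strong_induction_on generalizing π i with
  | _ n ih =>
    by_cases h1 : π = 1
    · subst h1; simp
    · obtain ⟨x, hx⟩ : ∃ x, π x ≠ x := by
        by_contra hc
        exact h1 (Equiv.ext fun x => not_not.mp fun h => hc ⟨x, h⟩)
      have hl : line x = line (π x) := ((mem_linePerms.mp hπ) x).symm
      have hs := mem_linePerms.mp (swap_mem_linePerms hl)
      have hdec : i ∘ π = (i ∘ Equiv.swap x (π x)) ∘ (Equiv.swap x (π x) * π) := by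
        funext p; simp
      have hmem : Equiv.swap x (π x) * π ∈ linePerms line :=
        mem_linePerms.mpr fun p => (hs (π p)).trans (mem_linePerms.mp hπ p)
      have hlt : (Equiv.swap x (π x) * π).support.card < n :=
        hn ▸ Equiv.Perm.card_support_swap_mul hx
      rw [hdec, ih _ hlt _ hmem _ rfl,
        hY _ _ (Ne.symm hx) hl, Equiv.Perm.sign_mul, Equiv.Perm.sign_swap (Ne.symm hx)]
      simp

theorem antisymmetrize_of_antisymm {line : P → ℕ} {Y : (P → I) → M}
    (hY : ∀ p q, p ≠ q → line p = line q → ∀ i, Y (i ∘ Equiv.swap p q) = -Y i) (i : P → I) :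
    antisymmetrize line Y i = Y i := by
  unfold antisymmetrize
  have h : ∀ π ∈ linePerms line,
      ((Equiv.Perm.sign π : ℤ) : ℝ) • Y (i ∘ π) = Y i := fun π hπ => by
    rw [comp_linePerm_of_antisymm hY π hπ, smul_smul]
    rcases Int.units_eq_one_or (Equiv.Perm.sign π) with h | h <;> simp [h]
  rw [Finset.sum_congr rfl h, Finset.sum_const, ← Nat.cast_smul_eq_nsmul ℝ,
    inv_smul_smul₀ (card_linePerms_pos line).ne']

theorem antisymmetrize_add (line : P → ℕ) (X Y : (P → I) → M) (i : P → I) :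
    antisymmetrize line (fun j => X j + Y j) i =
      antisymmetrize line X i + antisymmetrize line Y i := by
  simp [antisymmetrize, Finset.sum_add_distrib]

theorem antisymmetrize_neg (line : P → ℕ) (X : (P → I) → M) (i : P → I) :
    antisymmetrize line (fun j => -X j) i = -antisymmetrize line X i := by
  simp [antisymmetrize]

theorem antisymmetrize_smul (line : P → ℕ) (r : ℝ) (X : (P → I) → M) (i : P → I) :
    antisymmetrize line (fun j => r • X j) i = r • antisymmetrize line X i := by
  simp only [antisymmetrize, Finset.smul_sum]
  exact Finset.sum_congr rfl fun π _ => by module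

theorem antisymmetrize_sum {κ : Type} (s : Finset κ) (line : P → ℕ) (X : κ → (P → I) → M)
    (i : P → I) :
    antisymmetrize line (fun j => ∑ k ∈ s, X k j) i =
      ∑ k ∈ s, antisymmetrize line (X k) i := by
  simp only [antisymmetrize, Finset.smul_sum]
  rw [Finset.sum_comm]

end Young

variable {D : ℕ}

theorem gen_T_cyclic (α : Multiset (Fin D)) (a b c : Fin D) :
    gen (.T α a b c) + gen (.T α c a b) + gen (.T α b c a) = 0 := by
  simpa [gen] using quot_rel (Rel.T_cyclic α a b c)

/-- Since A is antisymmetric, the sum over the three cyclic rotations is already totally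
antisymmetric. Rotations are even, so its antisymmetrization is three times F^A. -/
theorem FA_eq (i : Fin 3 → Fin D) :
    FA i = (3⁻¹ : ℝ) • (gen (.A {i 2} (i 0) (i 1)) + gen (.A {i 0} (i 1) (i 2))
      + gen (.A {i 1} (i 2) (i 0))) := by
  let X : (Fin 3 → Fin D) → Alg D := fun j => gen (.A {j 2} (j 0) (j 1))
  let line : Fin 3 → ℕ := fun _ => 0
  let τ : Equiv.Perm (Fin 3) := Equiv.swap 0 1 * Equiv.swap 1 2
  let τ' : Equiv.Perm (Fin 3) := τ * τ
  let Y : (Fin 3 → Fin D) → Alg D := fun j => X j + X (j ∘ τ) + X (j ∘ τ')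
  have hτ : τ ∈ linePerms line := by simp [mem_linePerms, line]
  have hττ : τ' ∈ linePerms line := by simp [mem_linePerms, line]
  have hs : Equiv.Perm.sign τ = 1 := by decide
  have hs' : Equiv.Perm.sign τ' = 1 := by decide
  have hA : antisymmetrize line Y i = (3 : ℝ) • FA i := by
    simp only [Y]
    rw [antisymmetrize_add, antisymmetrize_add, antisymmetrize_comp_perm hτ,
      antisymmetrize_comp_perm hττ, hs, hs']
    change FA i + _ • FA i + _ • FA i = _
    simp only [Units.val_one, Int.cast_one]
    module
  have hY : antisymmetrize line Y i = Y i := by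
    refine antisymmetrize_of_antisymm (fun p q hpq _ j => ?_) i
    have e : ∀ j, Y j = gen (.A {j 2} (j 0) (j 1)) + gen (.A {j 0} (j 1) (j 2))
        + gen (.A {j 1} (j 2) (j 0)) := fun j => rfl
    rw [e, e]
    fin_cases p <;> fin_cases q <;> first | exact absurd rfl hpq | skip
    all_goals
      simp [Equiv.swap_apply_def]
      rw [gen_A_antisymm _ (j 1) (j 0), gen_A_antisymm _ (j 2) (j 1), gen_A_antisymm _ (j 0) (j 2)]
      abel
  rw [← inv_smul_smul₀ (three_ne_zero (α := ℝ)) (FA i), ← hA, hY]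
  rfl

/-! ### The Young projection of the derivatives of the field -/

theorem val_map_place (m : ℕ) (i : Place m → Fin D) :
    {i (.inl 0), i (.inl 1), i (.inl 2)} + Finset.univ.val.map (fun j => i (.inr j)) =
      Finset.univ.val.map i := by
  rw [← Finset.univ_disjSum_univ, Finset.val_disjSum, Multiset.disjSum, Multiset.map_add,
    Multiset.map_map, Multiset.map_map]
  rfl

/-- The multiset of all indices is unchanged by ρ; cancelling the three indices of T leaves the
derivative indices, whose order is immaterial. -/
theorem val_map_inr_comp (m : ℕ) (ρ : Equiv.Perm (Place m)) (i : Place m → Fin D)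
    (h : ({i (ρ (.inl 0)), i (ρ (.inl 1)), i (ρ (.inl 2))} : Multiset (Fin D)) =
      {i (.inl 0), i (.inl 1), i (.inl 2)}) :
    Finset.univ.val.map (fun j => i (ρ (.inr j))) =
      Finset.univ.val.map (fun j => i (.inr j)) := by
  have h1 := val_map_place m i
  have h2 := val_map_place m (i ∘ ρ)
  have h3 : Finset.univ.val.map (i ∘ ρ) = Finset.univ.val.map i := by
    rw [← Multiset.map_map, ← Equiv.coe_toEmbedding, ← Finset.map_val, Finset.map_univ_equiv]
  rw [h3, ← h1] at h2
  simp only [Function.comp] at h2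
  rw [h] at h2
  exact add_left_cancel h2

theorem derivT_swap_inr (m : ℕ) (j k : Fin (m + 2)) (i : Place m → Fin D) :
    derivT m (i ∘ Equiv.swap (.inr j) (.inr k)) = derivT m i := by
  have h : ∀ x, Equiv.swap (Sum.inr j : Place m) (.inr k) (.inl x) = .inl x := fun x =>
    Equiv.swap_apply_of_ne_of_ne (by simp) (by simp)
  have h1 := val_map_inr_comp m (Equiv.swap (.inr j) (.inr k)) i (by simp only [h])
  simp only [derivT, Function.comp, h, h1]

/-- The antisymmetrization of `∂_{d₁ …} T_{[ab]c}` over the columns of the tableau. -/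
def colT (m : ℕ) (i : Place m → Fin D) : Alg D := antisymmetrize (colE m) (derivT m) i

/-- The last derivative place is alone in its row, hence fixed, and it uses up column 0. The other
places of that column must then be filled from the places of T; rows force b to stay, so d_{m+1}
stays as well and uses up column 1. Only a and c can still be exchanged. -/
theorem colE_rowE_cases (m : ℕ) (ρ : Equiv.Perm (Place m)) (hρ : ρ ∈ linePerms (rowE m))
    (hinj : ∀ j k, colE m (ρ (.inr j)) = colE m (ρ (.inr k)) → j = k) :
    ρ (.inl 1) = .inl 1 ∧ ((ρ (.inl 0) = .inl 0 ∧ ρ (.inl 2) = .inl 2) ∨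
      (ρ (.inl 0) = .inl 2 ∧ ρ (.inl 2) = .inl 0)) := by
  have row := mem_linePerms.mp hρ
  have row2 : ∀ p : Place m, rowE m p = 2 → p = .inr (Fin.last (m + 1)) := by
    rintro (p | j) h
    · fin_cases p <;> simp [rowE] at h
    · simp only [rowE, Sum.elim_inr] at h
      split_ifs at h with h1 h2
      · omega
      · exact congrArg _ (Fin.ext (by simp; omega))
  have row1 : ∀ p : Place m, rowE m p = 1 → p = .inl 1 ∨ p = .inr ⟨m, by omega⟩ := by
    rintro (p | j) h
    · fin_cases p <;> simp [rowE] at h ⊢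
    · simp only [rowE, Sum.elim_inr] at h
      split_ifs at h with h1 h2
      · exact Or.inr (congrArg _ (Fin.ext h2))
      · omega
  have hlast : ρ (.inr (Fin.last (m + 1))) = .inr (Fin.last (m + 1)) :=
    row2 _ ((row _).trans (by simp [rowE]))
  have hcol0 : ∀ p : Place m, colE m p = 0 → p ≠ .inr (Fin.last (m + 1)) →
      ∃ x, ρ (.inl x) = p := by
    intro p hp hne
    rcases hq : ρ.symm p with x | j
    · exact ⟨x, by rw [← hq, Equiv.apply_symm_apply]⟩
    · have hj : ρ (.inr j) = p := by rw [← hq, Equiv.apply_symm_apply]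
      have := hinj j (Fin.last (m + 1)) (by rw [hj, hlast, hp]; simp [colE])
      subst this
      exact absurd (hj.symm.trans hlast) hne
  obtain ⟨x, hx⟩ := hcol0 (.inl 1) (by simp [colE]) (by simp)
  have hx1 : x = 1 := by
    have := row (.inl x)
    rw [hx] at this
    fin_cases x <;> simp [rowE] at this ⊢
  subst hx1
  have hm : ρ (.inr ⟨m, by omega⟩) = .inr ⟨m, by omega⟩ := by
    refine (row1 _ ((row _).trans (by simp [rowE]))).resolve_left fun h => ?_
    have := ρ.injective (h.trans hx.symm)
    simp at this
  have hcol1 : ∃ x, ρ (.inl x) = .inl 2 := by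
    rcases hq : ρ.symm (.inl 2) with x | j
    · exact ⟨x, by rw [← hq, Equiv.apply_symm_apply]⟩
    · have hj : ρ (.inr j) = .inl 2 := by rw [← hq, Equiv.apply_symm_apply]
      have := hinj j ⟨m, by omega⟩ (by rw [hj, hm]; simp [colE])
      subst this
      exact absurd (hj.symm.trans hm) (by simp)
  obtain ⟨y, hy⟩ := hcol0 (.inl 0) (by simp [colE]) (by simp)
  obtain ⟨z, hz⟩ := hcol1
  refine ⟨hx, ?_⟩
  have fin3 : ∀ x : Fin 3, x = 0 ∨ x = 1 ∨ x = 2 := by decide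
  rcases fin3 y with rfl | rfl | rfl
  · rcases fin3 z with rfl | rfl | rfl
    · exact absurd (hy.symm.trans hz) (by simp)
    · exact absurd (hx.symm.trans hz) (by simp)
    · exact Or.inl ⟨hy, hz⟩
  · exact absurd (hx.symm.trans hy) (by simp)
  · rcases fin3 z with rfl | rfl | rfl
    · exact Or.inr ⟨hz, hy⟩
    · exact absurd (hx.symm.trans hz) (by simp)
    · exact absurd (hy.symm.trans hz) (by simp)

/-- Two derivative places sent to one column give 0, since derivatives commute. Otherwise the three
T-places are fixed, giving 1, or a and c are exchanged, and the cyclic identity gives 1/2. -/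
theorem exists_antisymmetrize_comp_row (m : ℕ) (ρ : Equiv.Perm (Place m))
    (hρ : ρ ∈ linePerms (rowE m)) :
    ∃ r : ℝ, 0 ≤ r ∧ (ρ = 1 → r = 1) ∧ ∀ i : Place m → Fin D,
      antisymmetrize (colE m) (fun j => derivT m (j ∘ ρ)) i = r • colT m i := by
  by_cases h1 : ρ = 1
  · subst h1
    exact ⟨1, zero_le_one, fun _ => rfl, fun i => (one_smul ℝ _).symm⟩
  by_cases hinj : ∀ j k, colE m (ρ (.inr j)) = colE m (ρ (.inr k)) → j = k
  · obtain ⟨hb, ⟨ha, hc⟩ | ⟨ha, hc⟩⟩ := colE_rowE_cases m ρ hρ hinj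
    · refine ⟨1, zero_le_one, fun _ => rfl, fun i => ?_⟩
      have h : ∀ j : Place m → Fin D, derivT m (j ∘ ρ) = derivT m j := fun j => by
        simp only [derivT, Function.comp, ha, hb, hc,
          val_map_inr_comp m ρ j (by simp only [ha, hb, hc])]
      simp only [h, one_smul]
      rfl
    · refine ⟨2⁻¹, by positivity, fun h => absurd h h1, fun i => ?_⟩
      let W : (Place m → Fin D) → Alg D := fun j => derivT m (j ∘ ρ)
      have hW : ∀ j, W (j ∘ Equiv.swap (.inl 0) (.inl 1)) = -derivT m j + W j := fun j => by
        have hr : ∀ k, Equiv.swap (Sum.inl 0 : Place m) (.inl 1) (.inr k) = .inr k := fun x =>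
          Equiv.swap_apply_of_ne_of_ne (by simp) (by simp)
        have h2 : Equiv.swap (Sum.inl 0 : Place m) (.inl 1) (.inl 2) = .inl 2 :=
          Equiv.swap_apply_of_ne_of_ne (by simp) (by simp)
        have e : ∀ j : Place m → Fin D, W j = gen (.T (Finset.univ.val.map fun k => j (.inr k))
            (j (.inl 2)) (j (.inl 1)) (j (.inl 0))) := fun j => by
          have := val_map_inr_comp m ρ j (by
            simp only [ha, hb, hc, Multiset.insert_eq_cons]
            rw [Multiset.cons_swap, ← Multiset.cons_zero (j (.inl 0)), Multiset.cons_swap _ _ 0,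
              Multiset.cons_swap _ (j (.inl 0))]
            rfl)
          simp only [W, derivT, Function.comp, ha, hb, hc, this]
        rw [e, e]
        simp only [derivT, Function.comp, hr, h2, Equiv.swap_apply_left, Equiv.swap_apply_right]
        rw [gen_T_antisymm _ (j (.inl 2)) (j (.inl 1))]
        linear_combination (norm := module)
          gen_T_cyclic (Finset.univ.val.map fun k => j (.inr k)) (j (.inl 0)) (j (.inl 1))
            (j (.inl 2))
      have h3 := antisymmetrize_swap (line := colE m) (p := .inl 0) (q := .inl 1) (by simp)
        (by simp [colE]) W i
      simp only [hW] at h3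
      rw [antisymmetrize_add, antisymmetrize_neg] at h3
      change antisymmetrize (colE m) W i = _
      change -colT m i + _ = _ at h3
      linear_combination (norm := module) (2⁻¹ : ℝ) • h3
  · push Not at hinj
    obtain ⟨j, k, hjk, hne⟩ := hinj
    refine ⟨0, le_rfl, fun h => absurd h h1, fun i => ?_⟩
    rw [zero_smul]
    refine antisymmetrize_eq_zero (p := ρ (.inr j)) (q := ρ (.inr k))
      (fun h => hne (Sum.inr_injective (ρ.injective h))) hjk _ (fun i' => ?_) i
    have : (i' ∘ Equiv.swap (ρ (.inr j)) (ρ (.inr k))) ∘ ρ =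
        (i' ∘ ρ) ∘ Equiv.swap (.inr j) (.inr k) := by
      funext p
      simp only [Function.comp, Equiv.swap_apply_def, ρ.injective.eq_iff]
      split_ifs <;> rfl
    rw [this, derivT_swap_inr]

/-- The coefficients of the row permutations are nonnegative and the identity contributes 1, so
their sum cannot vanish. -/
theorem exists_ET_eq_smul_colT (m : ℕ) :
    ∃ r : ℝ, r ≠ 0 ∧ ∀ i : Place m → Fin D, ET m i = r • colT m i := by
  have h := exists_antisymmetrize_comp_row (D := D) m
  choose! r hr0 hr1 hr using h
  refine ⟨((linePerms (rowE m)).card : ℝ)⁻¹ * ∑ ρ ∈ linePerms (rowE m), r ρ,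
    (mul_pos (inv_pos.mpr (card_linePerms_pos _)) ?_).ne', fun i => ?_⟩
  · refine Finset.sum_pos' hr0 ⟨1, one_mem_linePerms _, ?_⟩
    rw [hr1 1 (one_mem_linePerms _) rfl]
    exact one_pos
  · unfold ET
    have : symmetrize (rowE m) (derivT (D := D) m) = fun j =>
        ((linePerms (rowE m)).card : ℝ)⁻¹ • ∑ ρ ∈ linePerms (rowE m), derivT m (j ∘ ρ) := rfl
    rw [this, antisymmetrize_smul, antisymmetrize_sum, Finset.sum_congr rfl fun ρ hρ => hr ρ hρ i,
      ← Finset.sum_smul, smul_smul]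

/-- `curlF` as a tensor on the places of the tableau. -/
def curlPlace (m : ℕ) (i : Place m → Fin D) : Alg D :=
  curlF (Finset.univ.val.map fun j : Fin m => i (.inr j.castSucc.castSucc))
    (i (.inl 0)) (i (.inl 1)) (i (.inr (Fin.last (m + 1))))
    (i (.inr (Fin.last m).castSucc)) (i (.inl 2))

theorem val_map_castSucc {n : ℕ} (f : Fin (n + 1) → Fin D) :
    Finset.univ.val.map f =
      f (Fin.last n) ::ₘ Finset.univ.val.map fun j : Fin n => f j.castSucc := by
  rw [Fin.univ_castSuccEmb, Finset.cons_val, Multiset.map_cons, Finset.map_val, Multiset.map_map]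
  rfl

theorem derivT_eq (m : ℕ) (i : Place m → Fin D) :
    derivT m i = gen (.T (i (.inr (Fin.last (m + 1))) ::ₘ i (.inr (Fin.last m).castSucc) ::ₘ
      Finset.univ.val.map fun j : Fin m => i (.inr j.castSucc.castSucc))
      (i (.inl 0)) (i (.inl 1)) (i (.inl 2))) := by
  rw [derivT, val_map_castSucc, val_map_castSucc]

theorem fieldStrength_swap (α : Multiset (Fin D)) (a b c d : Fin D) :
    fieldStrength α b a c d = -fieldStrength α a b c d := by
  simp only [fieldStrength]
  rw [gen_T_antisymm _ a c, gen_T_antisymm _ c b, gen_T_antisymm _ b a]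
  abel

theorem fieldStrength_cyclic (α : Multiset (Fin D)) (a b c d : Fin D) :
    fieldStrength α b c a d = fieldStrength α a b c d := by
  simp only [fieldStrength]
  abel

theorem curlF_swap (α : Multiset (Fin D)) (a b c d e : Fin D) :
    curlF α b a c d e = -curlF α a b c d e := by
  simp only [curlF]
  rw [fieldStrength_swap _ a b, fieldStrength_swap _ a b]
  abel

theorem curlF_cyclic (α : Multiset (Fin D)) (a b c d e : Fin D) :
    curlF α b c a d e = curlF α a b c d e := by
  simp only [curlF]
  rw [fieldStrength_cyclic _ a b, fieldStrength_cyclic _ a b]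

theorem curlF_swap_right (α : Multiset (Fin D)) (a b c d e : Fin D) :
    curlF α a b c e d = -curlF α a b c d e := by
  simp only [curlF]; abel

/-- The pairs of places in a common column of the tableau. -/
theorem colE_eq_cases (m : ℕ) (p q : Place m) (hpq : p ≠ q) (h : colE m p = colE m q) :
    ((p = .inl 0 ∧ q = .inl 1) ∨ (p = .inl 0 ∧ q = .inr (Fin.last (m + 1))) ∨
      (p = .inl 1 ∧ q = .inr (Fin.last (m + 1))) ∨
      (p = .inl 2 ∧ q = .inr (Fin.last m).castSucc)) ∨
    ((q = .inl 0 ∧ p = .inl 1) ∨ (q = .inl 0 ∧ p = .inr (Fin.last (m + 1))) ∨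
      (q = .inl 1 ∧ p = .inr (Fin.last (m + 1))) ∨
      (q = .inl 2 ∧ p = .inr (Fin.last m).castSucc)) := by
  have fin3 : ∀ x : Fin 3, x = 0 ∨ x = 1 ∨ x = 2 := by decide
  have col0 : ∀ j : Fin (m + 2), colE m (.inr j) = 0 → j = Fin.last (m + 1) := fun j hj => by
    simp only [colE, Sum.elim_inr] at hj
    split_ifs at hj with h1 h2
    exact Fin.ext (by simp only [Fin.val_last]; omega)
  have col1 : ∀ j : Fin (m + 2), colE m (.inr j) = 1 → j = (Fin.last m).castSucc := fun j hj => by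
    simp only [colE, Sum.elim_inr] at hj
    split_ifs at hj with h1 h2
    · omega
    · exact Fin.ext (by simp [h2])
  have e0 : colE m (.inl 0) = 0 := rfl
  have e1 : colE m (.inl 1) = 0 := rfl
  have e2 : colE m (.inl 2) = 1 := rfl
  rcases p with x | j <;> rcases q with y | k
  · rcases fin3 x with rfl | rfl | rfl <;> rcases fin3 y with rfl | rfl | rfl <;>
      simp [e0, e1, e2] at h hpq ⊢
  · rcases fin3 x with rfl | rfl | rfl
    · have := col0 k (h.symm.trans e0); subst this; simp
    · have := col0 k (h.symm.trans e1); subst this; simp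
    · have := col1 k (h.symm.trans e2); subst this; simp
  · rcases fin3 y with rfl | rfl | rfl
    · have := col0 j (h.trans e0); subst this; simp
    · have := col0 j (h.trans e1); subst this; simp
    · have := col1 j (h.trans e2); subst this; simp
  · exfalso
    apply hpq
    simp only [colE, Sum.elim_inr] at h
    have hj := j.2
    have hk := k.2
    congr 1
    apply Fin.ext
    split_ifs at h <;> omega

theorem swap_inl_inl {m : ℕ} (x y : Fin 3) (j : Fin (m + 2)) :
    Equiv.swap (.inl x : Place m) (.inl y) (.inr j) = .inr j :=
  Equiv.swap_apply_of_ne_of_ne (by simp) (by simp)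

theorem swap_inl_inr {m : ℕ} {x y : Fin 3} {j : Fin (m + 2)} (h : y ≠ x) :
    Equiv.swap (.inl x : Place m) (.inr j) (.inl y) = .inl y :=
  Equiv.swap_apply_of_ne_of_ne (by simpa using h) (by simp)

theorem swap_inl_inr' {m : ℕ} {x : Fin 3} {j k : Fin (m + 2)} (h : k ≠ j) :
    Equiv.swap (.inl x : Place m) (.inr j) (.inr k) = .inr k :=
  Equiv.swap_apply_of_ne_of_ne (by simp) (by simpa using h)

theorem swap_inl_inl' {m : ℕ} {x y z : Fin 3} (h : z ≠ x) (h' : z ≠ y) :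
    Equiv.swap (.inl x : Place m) (.inl y) (.inl z) = .inl z :=
  Equiv.swap_apply_of_ne_of_ne (by simpa using h) (by simpa using h')

theorem castSucc_castSucc_ne {m : ℕ} (j : Fin m) : j.castSucc.castSucc ≠ (Fin.last m).castSucc :=
  fun h => Fin.castSucc_ne_last j (Fin.castSucc_injective _ h)

theorem curlPlace_swap (m : ℕ) (p q : Place m) (hpq : p ≠ q) (h : colE m p = colE m q)
    (i : Place m → Fin D) : curlPlace m (i ∘ Equiv.swap p q) = -curlPlace m i := by
  wlog hc : (p = .inl 0 ∧ q = .inl 1) ∨ (p = .inl 0 ∧ q = .inr (Fin.last (m + 1))) ∨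
      (p = .inl 1 ∧ q = .inr (Fin.last (m + 1))) ∨
      (p = .inl 2 ∧ q = .inr (Fin.last m).castSucc) generalizing p q
  · rw [Equiv.swap_comm]
    exact this q p hpq.symm h.symm ((colE_eq_cases m p q hpq h).resolve_left hc)
  have hl : ∀ j : Fin (m + 1), j.castSucc ≠ Fin.last (m + 1) := fun j => Fin.castSucc_ne_last j
  have hl' := fun j => (hl j).symm
  have hw := castSucc_castSucc_ne (m := m)
  rcases hc with ⟨rfl, rfl⟩ | ⟨rfl, rfl⟩ | ⟨rfl, rfl⟩ | ⟨rfl, rfl⟩ <;>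
    simp only [curlPlace, Function.comp, Equiv.swap_apply_left, Equiv.swap_apply_right,
      swap_inl_inl, ne_eq, hl, hl', hw, not_false_eq_true, swap_inl_inr',
      swap_inl_inr (show (0 : Fin 3) ≠ 1 by decide), swap_inl_inr (show (2 : Fin 3) ≠ 1 by decide),
      swap_inl_inr (show (0 : Fin 3) ≠ 2 by decide), swap_inl_inr (show (1 : Fin 3) ≠ 2 by decide),
      swap_inl_inr (show (1 : Fin 3) ≠ 0 by decide), swap_inl_inr (show (2 : Fin 3) ≠ 0 by decide),
      swap_inl_inl' (show (2 : Fin 3) ≠ 0 by decide) (show (2 : Fin 3) ≠ 1 by decide)]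
  · exact curlF_swap ..
  · rw [← curlF_cyclic, curlF_swap]
  · rw [← curlF_cyclic, ← curlF_cyclic, curlF_swap]
  · exact curlF_swap_right ..

/-- The curl is antisymmetric within each column, so antisymmetrizing leaves it unchanged. Written
out it has 3 · 2 = 6 terms, each a signed column permutation of ∂…T, and each contributes the same
amount. -/
theorem curlPlace_eq (m : ℕ) (i : Place m → Fin D) : curlPlace m i = (6 : ℝ) • colT m i := by
  have hl : ∀ j : Fin (m + 1), j.castSucc ≠ Fin.last (m + 1) := fun j => Fin.castSucc_ne_last j
  have hl' := fun j => (hl j).symm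
  have hw := castSucc_castSucc_ne (m := m)
  let s : Equiv.Perm (Place m) := Equiv.swap (.inl 0) (.inl 1)
  let t : Equiv.Perm (Place m) := Equiv.swap (.inl 1) (.inr (Fin.last (m + 1)))
  let w : Equiv.Perm (Place m) := Equiv.swap (.inl 2) (.inr (Fin.last m).castSucc)
  have cs : ∀ (X : (Place m → Fin D) → Alg D) i,
      antisymmetrize (colE m) (fun j => X (j ∘ s)) i = -antisymmetrize (colE m) X i := fun X i =>
    antisymmetrize_swap (by simp) (by simp [colE]) X i
  have ct : ∀ (X : (Place m → Fin D) → Alg D) i,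
      antisymmetrize (colE m) (fun j => X (j ∘ t)) i = -antisymmetrize (colE m) X i := fun X i =>
    antisymmetrize_swap (by simp) (by simp [colE]) X i
  have cw : ∀ (X : (Place m → Fin D) → Alg D) i,
      antisymmetrize (colE m) (fun j => X (j ∘ w)) i = -antisymmetrize (colE m) X i := fun X i =>
    antisymmetrize_swap (by simp) (by simp [colE]) X i
  let G : (Place m → Fin D) → Alg D := fun j =>
    derivT m j + derivT m ((j ∘ s) ∘ t) + derivT m ((j ∘ t) ∘ s)
  have hG : ∀ i, antisymmetrize (colE m) G i = (3 : ℝ) • colT m i := fun i => by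
    simp only [G]
    rw [antisymmetrize_add, antisymmetrize_add, cs (fun j => derivT m (j ∘ t)), ct,
      ct (fun j => derivT m (j ∘ s)), cs]
    change colT m i + - -colT m i + - -colT m i = _
    module
  have hc : ∀ j, curlPlace (D := D) m j = G j + -G (j ∘ w) := fun j => by
    simp only [G, curlPlace, derivT_eq, curlF, fieldStrength, Function.comp, s, t, w,
      Equiv.swap_apply_left, Equiv.swap_apply_right,
      swap_inl_inl, ne_eq, hl, hl', hw, not_false_eq_true, swap_inl_inr',
      swap_inl_inr (show (0 : Fin 3) ≠ 1 by decide), swap_inl_inr (show (2 : Fin 3) ≠ 1 by decide),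
      swap_inl_inr (show (0 : Fin 3) ≠ 2 by decide), swap_inl_inr (show (1 : Fin 3) ≠ 2 by decide),
      swap_inl_inl' (show (2 : Fin 3) ≠ 0 by decide) (show (2 : Fin 3) ≠ 1 by decide)]
    abel
  rw [← antisymmetrize_of_antisymm (curlPlace_swap m) i, funext hc, antisymmetrize_add,
    antisymmetrize_neg, cw, hG]
  module

theorem exists_curlPlace_eq (α : Multiset (Fin D)) (a b c d e : Fin D) :
    ∃ i, curlPlace (Multiset.card α) i = curlF α a b c d e := by
  obtain ⟨f, hf⟩ : ∃ f : Fin (Multiset.card α) → Fin D, Finset.univ.val.map f = α := by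
    obtain ⟨l, rfl⟩ := Quot.exists_rep α
    exact ⟨l.get, (Fin.univ_val_map (n := l.length) l.get).trans
      (congrArg Multiset.ofList (List.ofFn_get l))⟩
  refine ⟨Sum.elim ![a, b, e] (Fin.snoc (Fin.snoc f d) c : Fin _ → Fin D), ?_⟩
  simp [curlPlace, hf]

theorem exists_ET_eq_smul_curlPlace (m : ℕ) :
    ∃ r : ℝ, r ≠ 0 ∧ ∀ i : Place m → Fin D, ET m i = r • curlPlace m i := by
  obtain ⟨r, hr, h⟩ := exists_ET_eq_smul_colT (D := D) m
  refine ⟨r * 6⁻¹, by positivity, fun i => ?_⟩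
  rw [h, curlPlace_eq]
  module

/-- The components `E^T` span the derivatives of the curl of the field strength. -/
theorem span_ET (m : ℕ) :
    Submodule.span ℝ (Set.range (ET (D := D) m)) =
      Submodule.span ℝ {x | ∃ (α : Multiset (Fin D)) (a b c d e : Fin D),
        Multiset.card α = m ∧ x = curlF α a b c d e} := by
  obtain ⟨r, hr, h⟩ := exists_ET_eq_smul_curlPlace (D := D) m
  apply le_antisymm <;> rw [Submodule.span_le]
  · rintro _ ⟨i, rfl⟩
    rw [h]
    exact Submodule.smul_mem _ _ (Submodule.subset_span ⟨_, _, _, _, _, _, by simp, rfl⟩)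
  · rintro _ ⟨α, a, b, c, d, e, rfl, rfl⟩
    obtain ⟨i, hi⟩ := exists_curlPlace_eq α a b c d e
    rw [← hi, ← inv_smul_smul₀ hr (curlPlace _ i), ← h]
    exact Submodule.smul_mem _ _ (Submodule.subset_span ⟨i, rfl⟩)

/-! ### Linear maps given on the generators -/

/-- A family of vectors indexed by the symbols, vanishing on the antifields. -/
def valVar {Q : Type} [Zero Q] (t : Multiset (Fin D) → Fin D → Fin D → Fin D → Q)
    (s h : Multiset (Fin D) → Fin D → Fin D → Q) (c : Multiset (Fin D) → Fin D → Q) : Var D → Q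
  | .T α a b d => t α a b d
  | .S α a b => s α a b
  | .A α a b => h α a b
  | .C α a => c α a
  | _ => 0

/-- The algebra has no linear relations beyond the stated symmetries. Sending the generators into
the square-zero part of ℝ ⊕ Q makes all products of generators vanish, so graded commutativity
imposes nothing. -/
theorem exists_linear {Q : Type} [AddCommGroup Q] [Module ℝ Q]
    (t : Multiset (Fin D) → Fin D → Fin D → Fin D → Q)
    (s h : Multiset (Fin D) → Fin D → Fin D → Q) (c : Multiset (Fin D) → Fin D → Q)
    (t_anti : ∀ α a b c, t α a b c = -t α b a c)
    (t_cyc : ∀ α a b c, t α a b c + t α c a b + t α b c a = 0)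
    (s_symm : ∀ α a b, s α a b = s α b a) (h_anti : ∀ α a b, h α a b = -h α b a) :
    ∃ L : Alg D →ₗ[ℝ] Q, ∀ u, L (gen u) = valVar t s h c u := by
  let _ : Module ℝᵐᵒᵖ Q := Module.compHom Q ((RingHom.id ℝ).fromOpposite mul_comm)
  have : IsCentralScalar ℝ Q := ⟨fun r m => rfl⟩
  let f : Var D → TrivSqZeroExt ℝ Q := fun u => TrivSqZeroExt.inr (valVar t s h c u)
  have hf : ∀ x y, Rel D x y → FreeAlgebra.lift ℝ f x = FreeAlgebra.lift ℝ f y := by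
    intro x y hxy
    cases hxy with
    | T_antisymm α a b c =>
      simp only [map_neg, FreeAlgebra.lift_ι_apply, f, valVar, ← TrivSqZeroExt.inr_neg]
      rw [t_anti]
    | T_cyclic α a b c =>
      simp only [map_add, map_zero, FreeAlgebra.lift_ι_apply, f, valVar,
        ← TrivSqZeroExt.inr_add, t_cyc, TrivSqZeroExt.inr_zero]
    | S_symm α a b =>
      simp only [FreeAlgebra.lift_ι_apply, f, valVar]
      rw [s_symm]
    | A_antisymm α a b =>
      simp only [map_neg, FreeAlgebra.lift_ι_apply, f, valVar, ← TrivSqZeroExt.inr_neg]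
      rw [h_anti]
    | antiT_antisymm α a b c => simp [f, valVar]
    | antiT_cyclic α a b c => simp [f, valVar]
    | supercomm u v => simp [f]
  refine ⟨TrivSqZeroExt.sndHom ℝ Q ∘ₗ (lift f hf).toLinearMap, fun u => ?_⟩
  simp [lift_gen, f]

/-! ### The homotopy on the generators -/

/-- The span of the derivatives of the field. -/
def spanT (D : ℕ) : Submodule ℝ (Alg D) :=
  Submodule.span ℝ {x | ∃ α a b c, x = gen (.T α a b c)}

/-- The span of the derivatives of the ghosts. -/
def spanGhost (D : ℕ) : Submodule ℝ (Alg D) :=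
  Submodule.span ℝ {x | ∃ α a b, x = gen (.S α a b) ∨ x = gen (.A α a b)}

/-- The span of the derivatives of the curl of the field strength. -/
def spanCurl (D : ℕ) : Submodule ℝ (Alg D) :=
  Submodule.span ℝ {x | ∃ α a b c d e, x = curlF α a b c d e}

/-- The span of the `F^A`. -/
def spanFA (D : ℕ) : Submodule ℝ (Alg D) := Submodule.span ℝ (Set.range FA)

theorem gen_T_mem (α : Multiset (Fin D)) (a b c : Fin D) : gen (.T α a b c) ∈ spanT D :=
  Submodule.subset_span ⟨α, a, b, c, rfl⟩

theorem gen_S_mem (α : Multiset (Fin D)) (a b : Fin D) : gen (.S α a b) ∈ spanGhost D :=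
  Submodule.subset_span ⟨α, a, b, Or.inl rfl⟩

theorem gen_A_mem (α : Multiset (Fin D)) (a b : Fin D) : gen (.A α a b) ∈ spanGhost D :=
  Submodule.subset_span ⟨α, a, b, Or.inr rfl⟩

theorem fieldStrength_mem (α : Multiset (Fin D)) (a b c d : Fin D) :
    fieldStrength α a b c d ∈ spanT D :=
  add_mem (add_mem (gen_T_mem _ _ _ _) (gen_T_mem _ _ _ _)) (gen_T_mem _ _ _ _)

theorem curlF_mem_spanT (α : Multiset (Fin D)) (a b c d e : Fin D) :
    curlF α a b c d e ∈ spanT D :=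
  sub_mem (fieldStrength_mem _ _ _ _ _) (fieldStrength_mem _ _ _ _ _)

theorem curlF_mem (α : Multiset (Fin D)) (a b c d e : Fin D) : curlF α a b c d e ∈ spanCurl D :=
  Submodule.subset_span ⟨α, a, b, c, d, e, rfl⟩

theorem spanCurl_le_spanT : spanCurl D ≤ spanT D := by
  rw [spanCurl, Submodule.span_le]
  rintro _ ⟨α, a, b, c, d, e, rfl⟩
  exact curlF_mem_spanT α a b c d e

theorem gamma_fieldStrength (α : Multiset (Fin D)) (a b c d : Fin D) :
    gamma D (fieldStrength α a b c d) = -(2 : ℝ) • (gen (.A (d ::ₘ a ::ₘ α) b c)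
      + gen (.A (d ::ₘ b ::ₘ α) c a) + gen (.A (d ::ₘ c ::ₘ α) a b)) := by
  simp only [fieldStrength, map_add, gamma_gen, gammaVar]
  rw [Multiset.cons_swap b a α, Multiset.cons_swap c a α, Multiset.cons_swap c b α]
  module

theorem gamma_curlF (α : Multiset (Fin D)) (a b c d e : Fin D) :
    gamma D (curlF α a b c d e) = 0 := by
  simp only [curlF, map_sub, gamma_fieldStrength]
  rw [Multiset.cons_swap a d, Multiset.cons_swap b d, Multiset.cons_swap c d,
    Multiset.cons_swap a e, Multiset.cons_swap b e, Multiset.cons_swap c e,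
    Multiset.cons_swap d e, Multiset.cons_swap d e, Multiset.cons_swap d e]
  module

theorem gamma_spanCurl {x : Alg D} (hx : x ∈ spanCurl D) : gamma D x = 0 := by
  have : spanCurl D ≤ LinearMap.ker (gamma D) := by
    rw [spanCurl, Submodule.span_le]
    rintro _ ⟨α, a, b, c, d, e, rfl⟩
    exact gamma_curlF ..
  exact this hx

theorem gamma_FA (i : Fin 3 → Fin D) : gamma D (FA i) = 0 := by
  simp only [FA_eq, map_smul, map_add, gamma_gen, gammaVar]
  simp only [← Multiset.cons_zero]
  rw [Multiset.cons_swap (i 0) (i 2), Multiset.cons_swap (i 1) (i 2),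
    Multiset.cons_swap (i 1) (i 0)]
  module

/-- A homotopy inverse of `γ` on the span of the derivatives of the field. -/
theorem exists_homotopy_spanT (D : ℕ) :
    ∃ σ : Alg D →ₗ[ℝ] Alg D, (∀ x, σ x ∈ spanT D) ∧
      ∀ t ∈ spanT D, σ (gamma D t) - t ∈ spanCurl D := by
  let R := (spanCurl D).submoduleOf (spanT D)
  let π : spanT D →ₗ[ℝ] (spanT D ⧸ R) := R.mkQ
  have hπ : ∀ x y : spanT D, (x : Alg D) - y ∈ spanCurl D → π x = π y := fun x y h =>
    (Submodule.Quotient.eq R).mpr h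
  let T : Multiset (Fin D) → Fin D → Fin D → Fin D → spanT D := fun α a b c =>
    ⟨gen (.T α a b c), gen_T_mem α a b c⟩
  -- Modulo curls the universal field has zero curvature, so it is pure gauge. Its gauge parameters,
  -- read as the images of S and A, define ρ with ρ ∘ γ = π; a linear section of π then gives σ.
  obtain ⟨s, h, hs, hh, hT⟩ := exists_gauge_of_curl_eq_zero (fun α a b c => π (T α a b c))
    (fun α a b c => by
      rw [← map_neg]
      exact congrArg π (Subtype.ext (gen_T_antisymm α a b c)))
    (fun α a b c => by
      rw [← map_add, ← map_add, ← map_zero π]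
      exact congrArg π (Subtype.ext (gen_T_cyclic α a b c)))
    (fun α a b c d e => by
      rw [← map_add, ← map_add, ← map_add, ← map_add]
      exact hπ _ _ (curlF_mem α a b c d e))
  obtain ⟨ρ, hρ⟩ := exists_linear (fun _ _ _ _ => (0 : spanT D ⧸ R)) s h (fun _ _ => 0)
    (by simp) (by simp) hs hh
  obtain ⟨g, hg⟩ := LinearMap.exists_rightInverse_of_surjective π
    (LinearMap.range_eq_top.mpr (Submodule.mkQ_surjective R))
  refine ⟨(spanT D).subtype ∘ₗ g ∘ₗ ρ, fun x => (g (ρ x)).2, fun t ht => ?_⟩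
  have h1 : ∀ x : spanT D, ρ (gamma D x) = π x := by
    rintro ⟨x, hx⟩
    unfold spanT at hx
    induction hx using Submodule.span_induction with
    | mem x hx =>
      obtain ⟨α, a, b, c, rfl⟩ := hx
      refine Eq.trans ?_ (hT α a b c).symm
      simp only [gamma_gen, gammaVar, map_sub, map_add, map_smul, hρ, valVar]
    | zero => rw [map_zero, map_zero]; exact (map_zero π).symm
    | add x y hx hy h1 h2 =>
      rw [map_add, map_add, h1, h2]
      exact (map_add π ⟨x, hx⟩ ⟨y, hy⟩).symm
    | smul r x hx h1 =>
      rw [map_smul, map_smul, h1]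
      exact (map_smul π r ⟨x, hx⟩).symm
  have h2 : π (g (ρ (gamma D t))) = π ⟨t, ht⟩ := by
    rw [← h1 ⟨t, ht⟩]
    exact LinearMap.congr_fun hg _
  exact (Submodule.Quotient.eq R).mp h2

/-- Total antisymmetrization of the first derivatives of `A`. -/
theorem exists_antisymm_projection (D : ℕ) :
    ∃ p : Alg D →ₗ[ℝ] Alg D, (∀ x, p x ∈ spanFA D) ∧ (∀ t ∈ spanT D, p (gamma D t) = 0) ∧
      ∀ x ∈ spanFA D, p x = x := by
  let Φ : Fin D → Fin D → Fin D → spanFA D := fun a b c =>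
    ⟨FA ![a, b, c], Submodule.subset_span ⟨_, rfl⟩⟩
  have Φanti : ∀ a b c, Φ a b c = -Φ b a c := fun a b c => Subtype.ext <| by
    simp only [Φ, Submodule.coe_neg, FA_eq, Matrix.cons_val]
    rw [gen_A_antisymm _ a b, gen_A_antisymm _ b c, gen_A_antisymm _ c a]
    module
  have Φcyc : ∀ a b c, Φ b c a = Φ a b c := fun a b c => Subtype.ext <| by
    simp only [Φ, FA_eq, Matrix.cons_val]
    module
  -- Only first derivatives of A are seen: `Φ` is defined on ∂_c A_{ab}, and all other orders go to
  -- 0.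
  let h : Multiset (Fin D) → Fin D → Fin D → spanFA D := fun α a b =>
    if Multiset.card α = 1 then (α.map fun c => Φ a b c).sum else 0
  have h_anti : ∀ α a b, h α a b = -h α b a := fun α a b => by
    simp only [h]
    split_ifs
    · rw [← Multiset.sum_map_neg]
      exact congrArg _ (Multiset.map_congr rfl fun c _ => Φanti a b c)
    · simp
  obtain ⟨p, hp⟩ := exists_linear (fun _ _ _ _ => (0 : spanFA D)) (fun _ _ _ => 0) h (fun _ _ => 0)
    (by simp) (by simp) (by simp) h_anti
  refine ⟨(spanFA D).subtype ∘ₗ p, fun x => (p x).2, fun t ht => ?_, fun x hx => ?_⟩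
  · unfold spanT at ht
    induction ht using Submodule.span_induction with
    | mem x hx =>
      obtain ⟨α, a, b, c, rfl⟩ := hx
      rw [LinearMap.comp_apply]
      convert (spanFA D).subtype.map_zero
      simp only [gamma_gen, gammaVar, map_sub, map_add, map_smul, hp, valVar, h,
        Multiset.card_cons]
      by_cases hα : α = 0
      · subst hα
        simp only [Multiset.card_zero, zero_add, if_true, Multiset.cons_zero,
          Multiset.map_singleton, Multiset.sum_singleton]
        rw [Φcyc a b c, Φanti a c b, ← Φcyc c a b]
        module
      · simp [hα]
    | zero => simp
    | add x y _ _ h1 h2 => rw [map_add, map_add, h1, h2, add_zero]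
    | smul r x _ h1 => rw [map_smul, map_smul, h1, smul_zero]
  · unfold spanFA at hx
    induction hx using Submodule.span_induction with
    | mem x hx =>
      obtain ⟨i, rfl⟩ := hx
      have e : FA i = Φ (i 0) (i 1) (i 2) := by simp [Φ, FA_eq]
      have e2 : p (FA i) = Φ (i 0) (i 1) (i 2) := by
        simp only [FA_eq, map_smul, map_add, hp, valVar, h, Multiset.card_singleton, if_true,
          Multiset.map_singleton, Multiset.sum_singleton]
        rw [Φcyc (i 0), Φcyc (i 2) (i 0) (i 1) |>.symm]
        module
      rw [LinearMap.comp_apply, e2, e]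
      rfl
    | zero => simp
    | add x y _ _ h1 h2 => rw [map_add, h1, h2]
    | smul r x _ h1 => rw [map_smul, h1]

/-- The combination of the ghosts whose image under `γ` is `∂_a C_b`. -/
def ghostN (α : Multiset (Fin D)) (a b : Fin D) : Alg D :=
  (6⁻¹ : ℝ) • gen (.S α a b) + (2⁻¹ : ℝ) • gen (.A α a b)

theorem ghostN_mem (α : Multiset (Fin D)) (a b : Fin D) : ghostN α a b ∈ spanGhost D :=
  add_mem (Submodule.smul_mem _ _ (gen_S_mem α a b)) (Submodule.smul_mem _ _ (gen_A_mem α a b))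

theorem gamma_ghostN (α : Multiset (Fin D)) (a b : Fin D) :
    gamma D (ghostN α a b) = gen (.C (a ::ₘ α) b) := by
  simp only [ghostN, map_add, map_smul, gamma_gen, gammaVar]
  module

theorem map_contr {I Q Q' : Type} [DecidableEq I] [AddCommGroup Q] [Module ℝ Q]
    [AddCommGroup Q'] [Module ℝ Q'] (L : Q →ₗ[ℝ] Q') (g : I → Multiset I → Q) (α : Multiset I) :
    L (contr g α) = contr (fun d β => L (g d β)) α := by
  simp [contr, map_multiset_sum]

/-- A contracting homotopy on the derivatives of the ghosts of ghosts. -/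
theorem exists_homotopy_C (D : ℕ) :
    ∃ κ : Alg D →ₗ[ℝ] Alg D, (∀ x, κ x ∈ spanGhost D) ∧ (∀ a, κ (gen (.C 0 a)) = 0) ∧
      (∀ α a b, gamma D (κ (gen (.C (a ::ₘ α) b))) = gen (.C (a ::ₘ α) b)) := by
  let N : Multiset (Fin D) → Fin D → Fin D → spanGhost D := fun α a b =>
    ⟨ghostN α a b, ghostN_mem α a b⟩
  -- The radial homotopy applied to C, with ∂_d C_b lifted to the ghosts through `ghostN`. At order
  -- zero the contraction is empty, so undifferentiated C_a go to 0.
  obtain ⟨κ, hκ⟩ := exists_linear (fun _ _ _ _ => (0 : spanGhost D)) (fun _ _ _ => 0)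
    (fun _ _ _ => 0) (fun α b => (Multiset.card α : ℝ)⁻¹ • contr (fun d β => N β d b) α)
    (by simp) (by simp) (by simp) (by simp)
  refine ⟨(spanGhost D).subtype ∘ₗ κ, fun x => (κ x).2, fun a => ?_, fun α a b => ?_⟩
  · rw [LinearMap.comp_apply, hκ]
    simp [valVar, contr]
  · rw [LinearMap.comp_apply, hκ]
    simp only [valVar, map_smul, map_contr]
    have : ∀ d β, gamma D ((spanGhost D).subtype (N β d b)) = gen (.C (d ::ₘ β) b) :=
      fun d β => gamma_ghostN β d b
    simp only [this]
    rw [contr_self (fun β => gen (.C β b)), inv_smul_smul₀]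
    rw [Multiset.card_cons]
    positivity

/-- The field strength of a gauge variation is -2 ∂_d (dh)_{abc}. If the variation vanishes then dh
is constant, and `h0` makes that constant zero. -/
theorem cyclic_eq_zero_of_gauge_trivial {I Q : Type} [AddCommGroup Q] [Module ℝ Q]
    (s h : Multiset I → I → I → Q) (hh : ∀ α a b, h α a b = -h α b a)
    (hT : ∀ α a b c, s (a ::ₘ α) b c - s (b ::ₘ α) a c + h (a ::ₘ α) b c - h (b ::ₘ α) a c
      - (2 : ℝ) • h (c ::ₘ α) a b = 0)
    (h0 : ∀ a b c, h {a} b c + h {b} c a + h {c} a b = 0) (α : Multiset I) (a b c : I) :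
    h (a ::ₘ α) b c + h (b ::ₘ α) c a + h (c ::ₘ α) a b = 0 := by
  induction α using Multiset.induction_on with
  | empty => exact h0 a b c
  | cons d α _ =>
    let φ : I → I → I → I → Q := fun d a b c =>
      h (a ::ₘ d ::ₘ α) b c + h (b ::ₘ d ::ₘ α) c a + h (c ::ₘ d ::ₘ α) a b
    have cyc : ∀ d a b c, φ d b c a = φ d a b c := fun d a b c => by simp only [φ]; abel
    have anti : ∀ d a b c, φ d b a c = -φ d a b c := fun d a b c => by
      simp only [φ]
      linear_combination (norm := module) hh (a ::ₘ d ::ₘ α) c b + hh (b ::ₘ d ::ₘ α) a c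
        + hh (c ::ₘ d ::ₘ α) b a
    -- The field strength of the trivial variation, with indices d, a, b and c: the terms in s
    -- cancel because derivatives commute.
    have key : ∀ a b c d, φ d a b c + φ a b d c + φ b d a c = 0 := fun a b c d => by
      have h1 := hT (d ::ₘ α) a b c
      have h2 := hT (a ::ₘ α) b d c
      have h3 := hT (b ::ₘ α) d a c
      simp only [φ]
      rw [Multiset.cons_swap a d, Multiset.cons_swap b a, Multiset.cons_swap d b] at *
      linear_combination (norm := module) -(2⁻¹ : ℝ) • (h1 + h2 + h3)
        + hh (b ::ₘ d ::ₘ α) c a + hh (a ::ₘ b ::ₘ α) c d + hh (d ::ₘ a ::ₘ α) c b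
    have anti' : ∀ d a b c, φ d a c b = -φ d a b c := fun d a b c => by
      rw [anti, cyc d c a b]
    have h1 := key a b c d
    have h2 := key c a b d
    have h3 := key b c a d
    have h4 := key a b d c
    rw [anti' a b c d, cyc b c d a] at h1
    rw [← cyc d c a b, anti c d a b, anti' a d b c, ← cyc a d b c] at h2
    rw [cyc d a b c, anti' c d a b] at h3
    rw [cyc c d a b, anti' b c d a] at h4
    change φ d a b c = 0
    -- By antisymmetry each instance of `key` relates the same four quantities, ∂ of one index on dh
    -- of the other three; this combination isolates one of them.
    linear_combination (norm := module) (3⁻¹ : ℝ) • (h1 + h2 + h3 + (2 : ℝ) • h4)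

/-- Modulo F^A and γ(∂…T), the 3-form dA vanishes to all orders, and then γT_{[ab]c} becomes 6(∂_a
N_{bc} - ∂_b N_{ac}) with N the combination `ghostN`. So N is closed in its first index, and the
Poincaré lemma gives ρ with ρ(∂_a C_b) = N_{ab}. Thus ρ ∘ γ is the quotient map on the ghosts, and
cocycles vanish in the quotient. -/
theorem exists_of_gamma_eq_zero {m : Alg D} (hm : m ∈ spanGhost D) (hγ : gamma D m = 0) :
    ∃ x ∈ spanFA D, ∃ t ∈ spanT D, x + gamma D t = m := by
  let R := spanFA D ⊔ (spanT D).map (gamma D)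
  let π : Alg D →ₗ[ℝ] (Alg D ⧸ R) := R.mkQ
  have hπ : ∀ x ∈ R, π x = 0 := fun x hx => (Submodule.Quotient.mk_eq_zero R).mpr hx
  have hφ := cyclic_eq_zero_of_gauge_trivial (fun α a b => π (gen (.S α a b)))
    (fun α a b => π (gen (.A α a b)))
    (fun α a b => by rw [gen_A_antisymm, map_neg])
    (fun α a b c => by
      rw [← map_smul, ← map_sub, ← map_add, ← map_sub, ← map_sub]
      refine hπ _ (Submodule.mem_sup_right ⟨_, gen_T_mem α a b c, ?_⟩)
      rw [gamma_gen]
      rfl)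
    (fun a b c => by
      rw [← map_add, ← map_add]
      refine hπ _ (Submodule.mem_sup_left ?_)
      have : FA ![a, b, c] ∈ spanFA D := Submodule.subset_span ⟨_, rfl⟩
      convert Submodule.smul_mem _ (3 : ℝ) this using 1
      rw [FA_eq]
      simp only [Matrix.cons_val]
      module)
  have closed : ∀ c α a b, π (ghostN (b ::ₘ α) a c) = π (ghostN (a ::ₘ α) b c) :=
      fun c α a b => by
    have h1 : π (gamma D (gen (.T α a b c))) = 0 :=
      hπ _ (Submodule.mem_sup_right ⟨_, gen_T_mem α a b c, rfl⟩)
    have h2 := hφ α a b c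
    have h3 := gen_A_antisymm (b ::ₘ α) c a
    simp only [gamma_gen, gammaVar, map_sub, map_add, map_smul] at h1
    rw [h3] at h2
    simp only [ghostN, map_add, map_smul, map_neg] at h2 ⊢
    linear_combination (norm := module) -(6⁻¹ : ℝ) • h1 - (3⁻¹ : ℝ) • h2
  obtain ⟨ρ, hρ⟩ := exists_linear (fun _ _ _ _ => (0 : Alg D ⧸ R)) (fun _ _ _ => 0)
    (fun _ _ _ => 0)
    (fun α b => (Multiset.card α : ℝ)⁻¹ • contr (fun d β => π (ghostN β d b)) α)
    (by simp) (by simp) (by simp) (by simp)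
  have hC : ∀ α a b, ρ (gen (.C (a ::ₘ α) b)) = π (ghostN α a b) := fun α a b => by
    rw [hρ]
    exact poincare_one (fun d β => π (ghostN β d b)) (closed b) a α
  have h1 : ∀ x ∈ spanGhost D, ρ (gamma D x) = π x := fun x hx => by
    unfold spanGhost at hx
    induction hx using Submodule.span_induction with
    | mem x hx =>
      obtain ⟨α, a, b, rfl | rfl⟩ := hx
      · simp only [gamma_gen, gammaVar, map_add, map_smul, hC, ghostN]
        rw [gen_S_symm α b a, gen_A_antisymm α b a, map_neg]
        module
      · simp only [gamma_gen, gammaVar, map_add, map_sub, map_smul, hC, ghostN]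
        rw [gen_S_symm α b a, gen_A_antisymm α b a, map_neg]
        module
    | zero => simp
    | add x y _ _ h1 h2 => rw [map_add, map_add, map_add, h1, h2]
    | smul r x _ h1 => rw [map_smul, map_smul, map_smul, h1]
  have h2 : π m = 0 := by rw [← h1 m hm, hγ, map_zero]
  replace h2 : m ∈ R := (Submodule.Quotient.mk_eq_zero R).mp h2
  obtain ⟨x, hx, _, ⟨t, ht, rfl⟩, hxt⟩ := Submodule.mem_sup.mp h2
  exact ⟨x, hx, t, ht, hxt⟩

/-! ### Extension to antiderivations and the full homotopy -/

/-- The span of the symbols whose parity is opposite to that of `u`. -/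
def spanOpp (u : Var D) : Submodule ℝ (Alg D) :=
  Submodule.span ℝ {x | ∃ v : Var D, v.odd = !u.odd ∧ x = gen v}

theorem gen_mem_spanOpp {u v : Var D} (h : v.odd = !u.odd) : gen v ∈ spanOpp u :=
  Submodule.subset_span ⟨v, h, rfl⟩

/-- The sign with which an image of v passes u, needed for an antiderivation to respect graded
commutativity. -/
theorem mul_gen_of_mem_spanOpp {v : Var D} {x : Alg D} (hx : x ∈ spanOpp v) (u : Var D) :
    x * gen u = (u.sgn * koszul u v) • (gen u * x) := by
  unfold spanOpp at hx
  induction hx using Submodule.span_induction with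
  | mem x hx =>
    obtain ⟨w, hw, rfl⟩ := hx
    rw [gen_supercomm w u]
    congr 1
    cases hv : v.odd <;> cases hu : u.odd <;> simp [koszul, Var.sgn, hw, hv, hu]
  | zero => simp
  | add x y _ _ h1 h2 => rw [add_mul, mul_add, smul_add, h1, h2]
  | smul r x _ h1 => rw [smul_mul_assoc, mul_smul_comm, h1, smul_comm]

theorem parity_of_mem_spanOpp {v : Var D} {x : Alg D} (hx : x ∈ spanOpp v) :
    parity D x = -(v.sgn • x) := by
  unfold spanOpp at hx
  induction hx using Submodule.span_induction with
  | mem x hx =>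
    obtain ⟨w, hw, rfl⟩ := hx
    rw [parity_gen]
    cases hv : v.odd <;> simp [Var.sgn, hw, hv]
  | zero => simp
  | add x y _ _ h1 h2 => rw [map_add, smul_add, neg_add, h1, h2]
  | smul r x _ h1 => rw [map_smul, h1, smul_neg, smul_comm]

theorem parity_parity (x : Alg D) : parity D (parity D x) = x := by
  induction x using alg_induction with
  | hs r => simp [parity_algebraMap]
  | hg u => cases h : u.odd <;> simp [parity_gen, Var.sgn, h]
  | hm x y hx hy => rw [parity_mul, parity_mul, hx, hy]
  | ha x y hx hy => rw [map_add, map_add, hx, hy]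

/-- A linear map that reverses the parity of the generators extends to an antiderivation. -/
theorem exists_antiderivation (L : Alg D →ₗ[ℝ] Alg D) (hL : ∀ u, L (gen u) ∈ spanOpp u) :
    ∃ h : Alg D →ₗ[ℝ] Alg D, (∀ u, h (gen u) = L (gen u)) ∧
      (∀ x y, h (x * y) = h x * y + parity D x * h y) ∧
      ∀ x, parity D (h x) = -h (parity D x) := by
  let f : Var D → Matrix (Fin 2) (Fin 2) (Alg D) := fun u =>
    !![u.sgn • gen u, L (gen u); 0, gen u]
  have hf : ∀ x y, Rel D x y → FreeAlgebra.lift ℝ f x = FreeAlgebra.lift ℝ f y := by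
    intro x y hxy
    have key := quot_rel hxy
    cases hxy with
    | T_antisymm α a b c =>
      simp only [fr, map_neg, FreeAlgebra.lift_ι_apply] at key ⊢
      change gen _ = -gen _ at key
      ext i j
      fin_cases i <;> fin_cases j <;> simp [f, Var.sgn, Var.odd, key]
    | T_cyclic α a b c =>
      simp only [fr, map_add, map_zero, FreeAlgebra.lift_ι_apply] at key ⊢
      change gen _ + gen _ + gen _ = 0 at key
      ext i j
      fin_cases i <;> fin_cases j <;> simp [f, Var.sgn, Var.odd, key, ← map_add]
    | S_symm α a b =>
      simp only [fr, FreeAlgebra.lift_ι_apply] at key ⊢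
      change gen _ = gen _ at key
      ext i j
      fin_cases i <;> fin_cases j <;> simp [f, Var.sgn, Var.odd, key]
    | A_antisymm α a b =>
      simp only [fr, map_neg, FreeAlgebra.lift_ι_apply] at key ⊢
      change gen _ = -gen _ at key
      ext i j
      fin_cases i <;> fin_cases j <;> simp [f, Var.sgn, Var.odd, key]
    | antiT_antisymm α a b c =>
      simp only [fr, map_neg, FreeAlgebra.lift_ι_apply] at key ⊢
      change gen _ = -gen _ at key
      ext i j
      fin_cases i <;> fin_cases j <;> simp [f, Var.sgn, Var.odd, key]
    | antiT_cyclic α a b c =>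
      simp only [fr, map_add, map_zero, FreeAlgebra.lift_ι_apply] at key ⊢
      change gen _ + gen _ + gen _ = 0 at key
      ext i j
      fin_cases i <;> fin_cases j <;>
        simp [f, Var.sgn, Var.odd, key, ← map_add, ← neg_add, -neg_add_rev]
    | supercomm u v =>
      clear key
      simp only [map_mul, map_smul, FreeAlgebra.lift_ι_apply]
      have h1 := gen_supercomm u v
      have h2 := mul_gen_of_mem_spanOpp (hL v) u
      have h3 := mul_gen_of_mem_spanOpp (hL u) v
      ext i j
      fin_cases i <;> fin_cases j <;> simp [f, Matrix.mul_apply, Fin.sum_univ_two]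
      · rw [h1, smul_smul, smul_smul, smul_smul, smul_smul]
        congr 1; ring
      · rw [h2, h3, add_comm]
        cases hu : u.odd <;> cases hv : v.odd <;> simp [koszul, Var.sgn, hu, hv]
      · exact h1
  let F : Alg D →ₐ[ℝ] Matrix (Fin 2) (Fin 2) (Alg D) := lift f hf
  have hF : ∀ u, F (gen u) = f u := lift_gen f hf
  have low : ∀ x, F x 0 0 = parity D x ∧ F x 1 0 = 0 ∧ F x 1 1 = x := fun x => by
    induction x using alg_induction with
    | hs r => simp [Matrix.algebraMap_matrix_apply, parity_algebraMap]
    | hg u => rw [hF]; simp [f, parity_gen]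
    | hm x y hx hy => simp [Matrix.mul_apply, Fin.sum_univ_two, hx, hy, parity_mul]
    | ha x y hx hy => simp [hx, hy]
  let h : Alg D →ₗ[ℝ] Alg D := (LinearMap.proj 1 ∘ₗ LinearMap.proj 0) ∘ₗ F.toLinearMap
  have hh : ∀ x, h x = F x 0 1 := fun x => rfl
  have hgen : ∀ u, h (gen u) = L (gen u) := fun u => by rw [hh, hF]; simp [f]
  have hmul : ∀ x y, h (x * y) = h x * y + parity D x * h y := fun x y => by
    simp [hh, Matrix.mul_apply, Fin.sum_univ_two, low, add_comm]
  refine ⟨h, hgen, hmul, fun x => ?_⟩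
  induction x using alg_induction with
  | hs r => simp [hh, Matrix.algebraMap_matrix_apply, parity_algebraMap]
  | hg u => rw [hgen, parity_of_mem_spanOpp (hL u), parity_gen, map_smul, hgen]
  | hm x y hx hy => simp [hmul, parity_mul, hx, hy]; abel
  | ha x y hx hy => simp [hx, hy]; abel

/-- γ of a ghost involves only C with at least one derivative, where γκ is the identity. -/
theorem gamma_spanGhost_homotopy {κ : Alg D →ₗ[ℝ] Alg D}
    (hκ : ∀ α a b, gamma D (κ (gen (.C (a ::ₘ α) b))) = gen (.C (a ::ₘ α) b))
    {m : Alg D} (hm : m ∈ spanGhost D) : gamma D (κ (gamma D m)) = gamma D m := by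
  unfold spanGhost at hm
  induction hm using Submodule.span_induction with
  | mem x hx =>
    obtain ⟨α, a, b, rfl | rfl⟩ := hx <;>
      simp only [gamma_gen, gammaVar, map_add, map_sub, map_smul, hκ]
  | zero => simp
  | add x y _ _ h1 h2 => simp only [map_add, h1, h2]
  | smul r x _ h1 => simp only [map_smul, h1]

/-- The antiderivation `h` such that `γ h + h γ` counts the generators that are not in the
cohomology. -/
structure IsHomotopy (h : Alg D →ₗ[ℝ] Alg D) : Prop where
  mul : ∀ x y, h (x * y) = h x * y + parity D x * h y
  parity : ∀ x, parity D (h x) = -h (parity D x)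
  spanT : ∀ t ∈ spanT D, h t = 0
  spanT_gamma : ∀ t ∈ MixedGauge.spanT D, h (gamma D t) - t ∈ spanCurl D
  spanGhost : ∀ m ∈ spanGhost D, ∃ f ∈ spanFA D, gamma D (h m) + h (gamma D m) = m - f
  spanFA : ∀ f ∈ spanFA D, h f = 0
  C_zero : ∀ a, h (gen (.C 0 a)) = 0
  C_cons : ∀ α a b, gamma D (h (gen (.C (a ::ₘ α) b))) = gen (.C (a ::ₘ α) b)
  antiT : ∀ α a b c, h (gen (.antiT α a b c)) = 0
  antiGhost : ∀ α a b, h (gen (.antiGhost α a b)) = 0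
  antiC : ∀ α a, h (gen (.antiC α a)) = 0

theorem spanFA_le_spanGhost : spanFA D ≤ spanGhost D := by
  rw [spanFA, Submodule.span_le]
  rintro _ ⟨i, rfl⟩
  rw [FA_eq]
  exact Submodule.smul_mem _ _ (add_mem (add_mem (gen_A_mem _ _ _) (gen_A_mem _ _ _))
    (gen_A_mem _ _ _))

theorem gamma_spanFA {f : Alg D} (hf : f ∈ spanFA D) : gamma D f = 0 := by
  have : spanFA D ≤ LinearMap.ker (gamma D) := by
    rw [spanFA, Submodule.span_le]
    rintro _ ⟨i, rfl⟩
    exact gamma_FA i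
  exact this hf

theorem exists_isHomotopy (D : ℕ) : ∃ h : Alg D →ₗ[ℝ] Alg D, IsHomotopy h := by
  obtain ⟨σ, hσT, hσ⟩ := exists_homotopy_spanT D
  obtain ⟨p, hp, hpT, hpFA⟩ := exists_antisymm_projection D
  obtain ⟨κ, hκ, hκ0, hκC⟩ := exists_homotopy_C D
  -- Subtracting κγ turns a ghost into a cocycle, of the form f + γt with f in the span of F^A;
  -- subtracting p removes f, and σ inverts γ on what is left up to curls.
  let Λ : Alg D →ₗ[ℝ] Alg D := σ ∘ₗ (LinearMap.id - p) ∘ₗ (LinearMap.id - κ ∘ₗ gamma D)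
  have hΛ : ∀ x, Λ x = σ ((x - κ (gamma D x)) - p (x - κ (gamma D x))) := fun x => rfl
  obtain ⟨L, hL⟩ := exists_linear (fun _ _ _ _ => (0 : Alg D)) (fun α a b => Λ (gen (.S α a b)))
    (fun α a b => Λ (gen (.A α a b))) (fun α a => κ (gen (.C α a))) (by simp) (by simp)
    (fun α a b => by rw [gen_S_symm]) (fun α a b => by rw [gen_A_antisymm, map_neg])
  have hLopp : ∀ u, L (gen u) ∈ spanOpp u := fun u => by
    have hT : ∀ u : Var D, u.odd = true → spanT D ≤ spanOpp u := fun u hu => by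
      rw [spanT, Submodule.span_le]
      rintro _ ⟨α, a, b, c, rfl⟩
      exact gen_mem_spanOpp (by rw [hu]; rfl)
    have hG : ∀ u : Var D, u.odd = false → spanGhost D ≤ spanOpp u := fun u hu => by
      rw [spanGhost, Submodule.span_le]
      rintro _ ⟨α, a, b, rfl | rfl⟩ <;> exact gen_mem_spanOpp (by rw [hu]; rfl)
    rw [hL]
    cases u with
    | S α a b => exact hT _ rfl (hσT _)
    | A α a b => exact hT _ rfl (hσT _)
    | C α a => exact hG _ rfl (hκ _)
    | _ => exact zero_mem _
  obtain ⟨h, hgen, hmul, hpar⟩ := exists_antiderivation L hLopp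
  replace hgen : ∀ u, h (gen u) = _ := fun u => (hgen u).trans (hL u)
  have hT : ∀ t ∈ spanT D, h t = 0 := fun t ht => by
    have : spanT D ≤ LinearMap.ker h := by
      rw [spanT, Submodule.span_le]
      rintro _ ⟨α, a, b, c, rfl⟩
      exact hgen _
    exact this ht
  have hG : ∀ m ∈ spanGhost D, h m = Λ m ∧ h (gamma D m) = κ (gamma D m) := fun m hm => by
    unfold spanGhost at hm
    induction hm using Submodule.span_induction with
    | mem x hx =>
      obtain ⟨α, a, b, rfl | rfl⟩ := hx
      · exact ⟨hgen _, by simp only [gamma_gen, gammaVar, map_add, map_smul, hgen, valVar]⟩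
      · exact ⟨hgen _, by simp only [gamma_gen, gammaVar, map_sub, hgen, valVar]⟩
    | zero => simp
    | add x y _ _ h1 h2 => simp only [map_add, h1, h2, and_self]
    | smul r x _ h1 => simp only [map_smul, h1, and_self]
  have hγT : ∀ t ∈ spanT D, gamma D t ∈ spanGhost D := fun t ht => by
    have : spanT D ≤ (spanGhost D).comap (gamma D) := by
      rw [spanT, Submodule.span_le]
      rintro _ ⟨α, a, b, c, rfl⟩
      change gamma D (gen _) ∈ spanGhost D
      rw [gamma_gen]
      exact sub_mem (sub_mem (add_mem (sub_mem (gen_S_mem _ _ _) (gen_S_mem _ _ _))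
        (gen_A_mem _ _ _)) (gen_A_mem _ _ _)) (Submodule.smul_mem _ _ (gen_A_mem _ _ _))
    exact this ht
  refine ⟨h, hmul, hpar, hT, fun t ht => ?_, fun m hm => ?_, fun f hf => ?_, fun a => ?_,
    fun α a b => ?_, fun _ _ _ _ => hgen _, fun _ _ _ => hgen _, fun _ _ => hgen _⟩
  · rw [(hG _ (hγT t ht)).1, hΛ, gamma_gamma, map_zero, sub_zero, hpT t ht, sub_zero]
    exact hσ t ht
  · have hm' : m - κ (gamma D m) ∈ spanGhost D := sub_mem hm (hκ _)
    obtain ⟨f, hf, t, ht, e⟩ := exists_of_gamma_eq_zero hm' (by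
      rw [map_sub, gamma_spanGhost_homotopy hκC hm, sub_self])
    refine ⟨f, hf, ?_⟩
    have e2 : gamma D (σ (gamma D t)) = gamma D t := by
      have := gamma_spanCurl (hσ t ht)
      rwa [map_sub, sub_eq_zero] at this
    rw [(hG m hm).1, (hG m hm).2, hΛ, ← e, map_add p, hpT t ht, hpFA f hf, add_zero,
      add_sub_cancel_left, e2]
    linear_combination (norm := module) e
  · rw [(hG f (spanFA_le_spanGhost hf)).1, hΛ, gamma_spanFA hf, map_zero, sub_zero, hpFA f hf,
      sub_self, map_zero]
  · rw [hgen]; exact hκ0 a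
  · rw [hgen]; exact hκC α a b

/-! ### The invariant algebra and the spectral decomposition of γh + hγ -/

theorem ET_mem_spanCurl (m : ℕ) (i : Place m → Fin D) : ET m i ∈ spanCurl D := by
  obtain ⟨r, -, hr⟩ := exists_ET_eq_smul_curlPlace (D := D) m
  rw [hr]
  exact Submodule.smul_mem _ _ (curlF_mem _ _ _ _ _ _)

theorem spanCurl_le_adjoin_setE {x : Alg D} (hx : x ∈ spanCurl D) :
    x ∈ Algebra.adjoin ℝ (setE D) := by
  have : spanCurl D ≤ Subalgebra.toSubmodule (Algebra.adjoin ℝ (setE D)) := by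
    rw [spanCurl, Submodule.span_le]
    rintro _ ⟨α, a, b, c, d, e, rfl⟩
    obtain ⟨r, hr, h⟩ := exists_ET_eq_smul_curlPlace (D := D) (Multiset.card α)
    obtain ⟨i, hi⟩ := exists_curlPlace_eq α a b c d e
    rw [← hi, ← inv_smul_smul₀ hr (curlPlace _ i), ← h]
    have hE : ET (Multiset.card α) i ∈ setE D := ⟨_, i, rfl⟩
    exact Subalgebra.smul_mem _ (Algebra.subset_adjoin hE) _
  exact this hx

theorem adjoin_setE_le : Algebra.adjoin ℝ (setE D) ≤ invariantAlg D :=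
  Algebra.adjoin_mono fun _ hx => Or.inl (Or.inr hx)

theorem gamma_invariantAlg {b : Alg D} (hb : b ∈ invariantAlg D) : gamma D b = 0 := by
  unfold invariantAlg at hb
  induction hb using Algebra.adjoin_induction with
  | mem x hx =>
    rcases hx with ((⟨a, rfl⟩ | ⟨i, rfl⟩) | ⟨m, i, rfl⟩) | hx
    · exact gamma_gen _
    · exact gamma_FA i
    · exact gamma_spanCurl (ET_mem_spanCurl m i)
    · rcases hx with ⟨α, a, b, c, rfl⟩ | ⟨α, a, b, rfl⟩ | ⟨α, a, rfl⟩ <;> exact gamma_gen _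
  | algebraMap r => exact gamma_algebraMap r
  | add x y _ _ h1 h2 => rw [map_add, h1, h2, add_zero]
  | mul x y _ _ h1 h2 => rw [gamma_mul, h1, h2, zero_mul, mul_zero, add_zero]

/-- The derivation `γ h + h γ`. -/
def counting (h : Alg D →ₗ[ℝ] Alg D) : Module.End ℝ (Alg D) := gamma D ∘ₗ h + h ∘ₗ gamma D

theorem counting_apply (h : Alg D →ₗ[ℝ] Alg D) (x : Alg D) :
    counting h x = gamma D (h x) + h (gamma D x) := rfl

/-- The sum of the eigenspaces of `γ h + h γ` to the positive integers. -/
def positivePart (h : Alg D →ₗ[ℝ] Alg D) : Submodule ℝ (Alg D) :=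
  ⨆ n : ℕ, (counting h).eigenspace ((n : ℝ) + 1)

theorem mem_positivePart {h : Alg D →ₗ[ℝ] Alg D} {x : Alg D} (n : ℕ)
    (hx : counting h x = ((n : ℝ) + 1) • x) : x ∈ positivePart h :=
  (le_iSup (fun n : ℕ => (counting h).eigenspace ((n : ℝ) + 1)) n)
    (Module.End.mem_eigenspace_iff.mpr hx)

theorem mem_positivePart_one {h : Alg D →ₗ[ℝ] Alg D} {x : Alg D} (hx : counting h x = x) :
    x ∈ positivePart h :=
  mem_positivePart 0 (by simpa using hx)

theorem positivePart_induction {h : Alg D →ₗ[ℝ] Alg D} {p : Alg D → Prop} {y : Alg D}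
    (hy : y ∈ positivePart h)
    (mem : ∀ (n : ℕ) x, counting h x = ((n : ℝ) + 1) • x → p x) (zero : p 0)
    (add : ∀ x y, p x → p y → p (x + y)) : p y :=
  Submodule.iSup_induction _ (motive := p) hy
    (fun n x hx => mem n x (Module.End.mem_eigenspace_iff.mp hx)) zero add

theorem exists_counting_eq {h : Alg D →ₗ[ℝ] Alg D} {y : Alg D} (hy : y ∈ positivePart h) :
    ∃ z ∈ positivePart h, counting h z = y := by
  refine positivePart_induction (p := fun y => ∃ z ∈ positivePart h, counting h z = y) hy
    (fun n x hx => ?_) ⟨0, zero_mem _, map_zero _⟩ ?_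
  · refine ⟨((n : ℝ) + 1)⁻¹ • x, Submodule.smul_mem _ _ (mem_positivePart n hx), ?_⟩
    rw [map_smul, hx, inv_smul_smul₀ (by positivity)]
  · rintro _ _ ⟨z, hz, rfl⟩ ⟨w, hw, rfl⟩
    exact ⟨z + w, add_mem hz hw, map_add _ _ _⟩

/-- Eigenspaces for distinct eigenvalues are independent, and 0 is not among the eigenvalues n + 1.
-/
theorem eq_zero_of_counting_eq_zero {h : Alg D →ₗ[ℝ] Alg D} {y : Alg D}
    (hy : y ∈ positivePart h) (h0 : counting h y = 0) : y = 0 := by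
  have hind := (counting h).eigenspaces_iSupIndep
  have hd : Disjoint ((counting h).eigenspace 0) (positivePart h) := by
    refine (hind 0).mono_right (iSup_le fun n => ?_)
    have : ((n : ℝ) + 1) ≠ 0 := by positivity
    exact le_iSup₂_of_le ((n : ℝ) + 1) this le_rfl
  exact Submodule.disjoint_def.mp hd y
    (Module.End.mem_eigenspace_iff.mpr (by rw [h0, zero_smul])) hy

theorem gamma_mem_positivePart {h : Alg D →ₗ[ℝ] Alg D} {y : Alg D} (hy : y ∈ positivePart h) :
    gamma D y ∈ positivePart h := by
  refine positivePart_induction (p := fun y => gamma D y ∈ positivePart h) hy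
    (fun n x hx => mem_positivePart n ?_) ?_ fun x y hx hy => ?_
  · rw [← map_smul, ← hx, counting_apply, counting_apply, gamma_gamma, map_zero, map_add,
      gamma_gamma, zero_add, add_zero]
  · rw [map_zero]; exact zero_mem _
  · rw [map_add]; exact add_mem hx hy

/-- Write y = Nz. As N commutes with γ and is injective on the positive part, γz = 0, so y = γhz. -/
theorem eq_gamma_of_gamma_eq_zero {h : Alg D →ₗ[ℝ] Alg D} {y : Alg D}
    (hy : y ∈ positivePart h) (h0 : gamma D y = 0) : ∃ z, gamma D z = y := by
  obtain ⟨z, hz, rfl⟩ := exists_counting_eq hy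
  have hz0 : gamma D z = 0 := by
    refine eq_zero_of_counting_eq_zero (gamma_mem_positivePart hz) ?_
    rw [counting_apply, map_add, gamma_gamma, zero_add] at h0
    rw [counting_apply, h0, gamma_gamma, map_zero, add_zero]
  exact ⟨h z, by rw [counting_apply, hz0, map_zero, add_zero]⟩

namespace IsHomotopy

variable {h : Alg D →ₗ[ℝ] Alg D} (hh : IsHomotopy h)
include hh

theorem counting_mul (x y : Alg D) :
    counting h (x * y) = counting h x * y + x * counting h y := by
  simp only [counting_apply, gamma_mul, hh.mul, map_add, parity_gamma, hh.parity, parity_parity,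
    add_mul, mul_add, neg_mul]
  abel

theorem map_algebraMap (r : ℝ) : h (algebraMap ℝ _ r) = 0 := by
  have h1 : h 1 = 0 := by
    have := hh.mul 1 1
    have h2 := parity_algebraMap (D := D) 1
    rw [map_one] at h2
    rw [h2, mul_one, mul_one, one_mul] at this
    exact left_eq_add.mp this
  rw [Algebra.algebraMap_eq_smul_one, map_smul, h1, smul_zero]

theorem map_invariantAlg {b : Alg D} (hb : b ∈ invariantAlg D) : h b = 0 := by
  unfold invariantAlg at hb
  induction hb using Algebra.adjoin_induction with
  | mem x hx =>
    rcases hx with ((⟨a, rfl⟩ | ⟨i, rfl⟩) | ⟨m, i, rfl⟩) | hx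
    · exact hh.C_zero a
    · exact hh.spanFA _ (Submodule.subset_span ⟨i, rfl⟩)
    · exact hh.spanT _ (spanCurl_le_spanT (ET_mem_spanCurl m i))
    · rcases hx with ⟨α, a, b, c, rfl⟩ | ⟨α, a, b, rfl⟩ | ⟨α, a, rfl⟩
      · exact hh.antiT ..
      · exact hh.antiGhost ..
      · exact hh.antiC ..
  | algebraMap r => exact hh.map_algebraMap r
  | add x y _ _ h1 h2 => rw [map_add, h1, h2, add_zero]
  | mul x y _ _ h1 h2 => rw [hh.mul, h1, h2, zero_mul, mul_zero, add_zero]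

theorem map_fieldAlg {f : Alg D} (hf : f ∈ fieldAlg D) : h f = 0 := by
  unfold fieldAlg fieldAlgOrder at hf
  induction hf using Algebra.adjoin_induction with
  | mem x hx =>
    obtain ⟨α, a, b, c, -, rfl⟩ := hx
    exact hh.spanT _ (gen_T_mem α a b c)
  | algebraMap r => exact hh.map_algebraMap r
  | add x y _ _ h1 h2 => rw [map_add, h1, h2, add_zero]
  | mul x y _ _ h1 h2 => rw [hh.mul, h1, h2, zero_mul, mul_zero, add_zero]

theorem counting_invariantAlg {b : Alg D} (hb : b ∈ invariantAlg D) : counting h b = 0 := by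
  rw [counting_apply, hh.map_invariantAlg hb, gamma_invariantAlg hb, map_zero, map_zero, add_zero]

/-- N is a derivation, so eigenvalues add under multiplication and the invariant factors have
eigenvalue 0. A general subalgebra `B` is allowed so that polynomials in the E^T alone are covered
too. -/
theorem mul_mem_sup {B : Subalgebra ℝ (Alg D)} (hB : B ≤ invariantAlg D) {x y : Alg D}
    (hx : x ∈ Subalgebra.toSubmodule B ⊔ positivePart h)
    (hy : y ∈ Subalgebra.toSubmodule B ⊔ positivePart h) :
    x * y ∈ Subalgebra.toSubmodule B ⊔ positivePart h := by
  obtain ⟨b, hb, p, hp, rfl⟩ := Submodule.mem_sup.mp hx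
  obtain ⟨c, hc, q, hq, rfl⟩ := Submodule.mem_sup.mp hy
  have hb0 := hh.counting_invariantAlg (hB hb)
  have hc0 := hh.counting_invariantAlg (hB hc)
  have h1 : b * q ∈ positivePart h := by
    refine positivePart_induction (p := fun q => b * q ∈ positivePart h) hq
      (fun n x hx => mem_positivePart n ?_) ?_ fun x y h1 h2 => ?_
    · rw [hh.counting_mul, hb0, zero_mul, zero_add, hx, mul_smul_comm]
    · rw [mul_zero]; exact zero_mem _
    · rw [mul_add]; exact add_mem h1 h2
  have h2 : p * c ∈ positivePart h := by
    refine positivePart_induction (p := fun p => p * c ∈ positivePart h) hp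
      (fun n x hx => mem_positivePart n ?_) ?_ fun x y h1 h2 => ?_
    · rw [hh.counting_mul, hc0, mul_zero, add_zero, hx, smul_mul_assoc]
    · rw [zero_mul]; exact zero_mem _
    · rw [add_mul]; exact add_mem h1 h2
  have h3 : p * q ∈ positivePart h := by
    refine positivePart_induction (p := fun p => p * q ∈ positivePart h) hp
      (fun n x hx => ?_) ?_ fun x y h1 h2 => ?_
    · refine positivePart_induction (p := fun q => x * q ∈ positivePart h) hq
        (fun k y hy => mem_positivePart (n + k + 1) ?_) ?_ fun x y h1 h2 => ?_
      · rw [hh.counting_mul, hx, hy, smul_mul_assoc, mul_smul_comm, ← add_smul]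
        push_cast
        congr 1
        ring
      · rw [mul_zero]; exact zero_mem _
      · rw [mul_add]; exact add_mem h1 h2
    · rw [zero_mul]; exact zero_mem _
    · rw [add_mul]; exact add_mem h1 h2
  rw [add_mul, mul_add, mul_add]
  exact add_mem (add_mem (Submodule.mem_sup_left (B.mul_mem hb hc)) (Submodule.mem_sup_right h1))
    (Submodule.mem_sup_right (add_mem h2 h3))

/-- Split T = (T - hγT) + hγT: the first term is a combination of curls, killed by both γ and `h`,
and so the second has eigenvalue 1. -/
theorem gen_T_mem_sup (α : Multiset (Fin D)) (a b c : Fin D) :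
    gen (.T α a b c) ∈
      Subalgebra.toSubmodule (Algebra.adjoin ℝ (setE D)) ⊔ positivePart h := by
  have hr := hh.spanT_gamma _ (gen_T_mem α a b c)
  refine Submodule.mem_sup.mpr ⟨_, Submodule.neg_mem _ (spanCurl_le_adjoin_setE hr),
    h (gamma D (gen (.T α a b c))), mem_positivePart_one ?_, by abel⟩
  have h1 := gamma_spanCurl hr
  rw [map_sub, sub_eq_zero] at h1
  have h2 := hh.spanT _ (spanCurl_le_spanT hr)
  rw [map_sub, hh.spanT _ (gen_T_mem α a b c), sub_zero] at h2
  rw [counting_apply, h1, h2, map_zero, zero_add]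

theorem mem_sup (x : Alg D) :
    x ∈ Subalgebra.toSubmodule (invariantAlg D) ⊔ positivePart h := by
  have anti : ∀ u : Var D, gen u ∈ setAntifields D →
      gen u ∈ Subalgebra.toSubmodule (invariantAlg D) ⊔ positivePart h := fun u hu =>
    Submodule.mem_sup_left (Algebra.subset_adjoin (Or.inr hu))
  have ghost : ∀ m ∈ MixedGauge.spanGhost D,
      m ∈ Subalgebra.toSubmodule (invariantAlg D) ⊔ positivePart h := fun m hm => by
    obtain ⟨f, hf, e⟩ := hh.spanGhost m hm
    have hfB : f ∈ Subalgebra.toSubmodule (invariantAlg D) := by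
      have : MixedGauge.spanFA D ≤ Subalgebra.toSubmodule (invariantAlg D) := by
        rw [MixedGauge.spanFA, Submodule.span_le]
        exact fun y hy => Algebra.subset_adjoin (Or.inl (Or.inl (Or.inr hy)))
      exact this hf
    refine Submodule.mem_sup.mpr ⟨f, hfB, m - f, mem_positivePart_one ?_, by abel⟩
    rw [map_sub, hh.counting_invariantAlg hfB, sub_zero, ← e]
    rfl
  induction x using alg_induction with
  | hs r => exact Submodule.mem_sup_left (Subalgebra.algebraMap_mem _ r)
  | hg u =>
    cases u with
    | T α a b c =>
      exact sup_le_sup_right (Subalgebra.toSubmodule.monotone adjoin_setE_le) _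
        (hh.gen_T_mem_sup α a b c)
    | S α a b => exact ghost _ (gen_S_mem α a b)
    | A α a b => exact ghost _ (gen_A_mem α a b)
    | C α b =>
      induction α using Multiset.induction_on with
      | empty =>
        exact Submodule.mem_sup_left (Algebra.subset_adjoin (Or.inl (Or.inl (Or.inl ⟨b, rfl⟩))))
      | cons a α _ =>
        refine Submodule.mem_sup_right (mem_positivePart_one ?_)
        rw [counting_apply, hh.C_cons, gamma_gen, gammaVar, map_zero, add_zero]
    | antiT α a b c => exact anti _ (Or.inl ⟨α, a, b, c, rfl⟩)
    | antiGhost α a b => exact anti _ (Or.inr (Or.inl ⟨α, a, b, rfl⟩))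
    | antiC α a => exact anti _ (Or.inr (Or.inr ⟨α, a, rfl⟩))
  | hm x y hx hy => exact hh.mul_mem_sup le_rfl hx hy
  | ha x y hx hy => exact add_mem hx hy

theorem exists_cohomologous {x : Alg D} (hx : gamma D x = 0) :
    ∃ b ∈ invariantAlg D, ∃ z, x = b + gamma D z := by
  obtain ⟨b, hb, y, hy, rfl⟩ := Submodule.mem_sup.mp (hh.mem_sup x)
  rw [map_add, gamma_invariantAlg hb, zero_add] at hx
  obtain ⟨z, rfl⟩ := eq_gamma_of_gamma_eq_zero hy hx
  exact ⟨b, hb, z, rfl⟩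

/-- Only the positive component of z contributes to γz, so γz lies in the positive part; being
invariant, it is also killed by N. -/
theorem eq_zero_of_mem_invariantAlg {z : Alg D} (hz : gamma D z ∈ invariantAlg D) :
    gamma D z = 0 := by
  obtain ⟨b, hb, y, hy, rfl⟩ := Submodule.mem_sup.mp (hh.mem_sup z)
  rw [map_add, gamma_invariantAlg hb, zero_add] at hz ⊢
  exact eq_zero_of_counting_eq_zero (gamma_mem_positivePart hy) (hh.counting_invariantAlg hz)

/-- Both γ and `h` kill f and its invariant component, so N kills the positive component, which is
therefore zero. This gives equality rather than mere cohomology. -/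
theorem mem_adjoin_of_gamma_eq_zero {f : Alg D} (hf : f ∈ fieldAlg D) (h0 : gamma D f = 0) :
    f ∈ Algebra.adjoin ℝ (setE D) := by
  have hsup : f ∈ Subalgebra.toSubmodule (Algebra.adjoin ℝ (setE D)) ⊔ positivePart h := by
    clear h0
    unfold fieldAlg fieldAlgOrder at hf
    induction hf using Algebra.adjoin_induction with
    | mem x hx =>
      obtain ⟨α, a, b, c, -, rfl⟩ := hx
      exact hh.gen_T_mem_sup α a b c
    | algebraMap r => exact Submodule.mem_sup_left (Subalgebra.algebraMap_mem _ r)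
    | add x y _ _ h1 h2 => exact add_mem h1 h2
    | mul x y _ _ h1 h2 => exact hh.mul_mem_sup adjoin_setE_le h1 h2
  obtain ⟨b, hb, y, hy, rfl⟩ := Submodule.mem_sup.mp hsup
  have hbB := adjoin_setE_le hb
  have h1 := hh.map_fieldAlg hf
  rw [map_add, hh.map_invariantAlg hbB, zero_add] at h1
  rw [map_add, gamma_invariantAlg hbB, zero_add] at h0
  rw [eq_zero_of_counting_eq_zero hy (by rw [counting_apply, h0, h1, map_zero, map_zero, add_zero]),
    add_zero]
  exact hb

end IsHomotopy

/-- The invariant generators are cocycles and generate the cohomology freely. -/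
theorem bijective_invariantAlg (D : ℕ) :
    ∃ h : ∀ b ∈ invariantAlg D, b ∈ cocycles D,
      Function.Bijective (fun b : invariantAlg D =>
        (Submodule.Quotient.mk ⟨(b : Alg D), h b b.2⟩ : Cohomology D)) := by
  obtain ⟨h, hh⟩ := exists_isHomotopy D
  refine ⟨fun b hb => gamma_invariantAlg hb, ?_, ?_⟩
  · rintro ⟨b, hb⟩ ⟨c, hc⟩ hbc
    obtain ⟨z, hz⟩ : b - c ∈ coboundaries D := 
      (Submodule.Quotient.eq ((coboundaries D).submoduleOf (cocycles D))).mp hbc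
    have h0 := hh.eq_zero_of_mem_invariantAlg (z := z) (hz ▸ sub_mem hb hc)
    rw [hz, sub_eq_zero] at h0
    exact Subtype.ext h0
  · intro q
    obtain ⟨⟨x, hx⟩, rfl⟩ := Submodule.Quotient.mk_surjective _ q
    obtain ⟨b, hb, z, rfl⟩ := hh.exists_cohomologous hx
    refine ⟨⟨b, hb⟩, (Submodule.Quotient.eq _).mpr ⟨-z, ?_⟩⟩
    change gamma D (-z) = b - (b + gamma D z)
    rw [map_neg]
    abel

/-! ### Evaluation on jets and strict gauge invariance -/

theorem FieldJet.eval_gen (t : FieldJet D) (u : Var D) : t.eval (gen u) = t.evalVar u :=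
  lift_gen _ _ u

theorem FieldJet.eval_congr {p : ℕ → Prop} {f : Alg D} (hf : f ∈ fieldAlgOrder D p)
    {t t' : FieldJet D} (h : ∀ α a b c, p (Multiset.card α) → t.val α a b c = t'.val α a b c) :
    t.eval f = t'.eval f := by
  unfold fieldAlgOrder at hf
  induction hf using Algebra.adjoin_induction with
  | mem x hx =>
    obtain ⟨α, a, b, c, hα, rfl⟩ := hx
    rw [eval_gen, eval_gen]
    exact h α a b c hα
  | algebraMap r => rw [AlgHom.commutes, AlgHom.commutes]
  | add x y _ _ h1 h2 => rw [map_add, map_add, h1, h2]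
  | mul x y _ _ h1 h2 => rw [map_mul, map_mul, h1, h2]

theorem gen_T_mem_fieldAlg (α : Multiset (Fin D)) (a b c : Fin D) :
    gen (.T α a b c) ∈ fieldAlg D :=
  Algebra.subset_adjoin ⟨α, a, b, c, trivial, rfl⟩

theorem spanT_le_fieldAlg {x : Alg D} (hx : x ∈ spanT D) : x ∈ fieldAlg D := by
  have : spanT D ≤ Subalgebra.toSubmodule (fieldAlg D) := by
    rw [spanT, Submodule.span_le]
    rintro _ ⟨α, a, b, c, rfl⟩
    exact gen_T_mem_fieldAlg α a b c
  exact this hx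

/-- The jet of the field on which the derivatives of `T` take the values of a linear form. -/
def FieldJet.ofLinear (l : spanT D →ₗ[ℝ] ℝ) : FieldJet D where
  val α a b c := l ⟨gen (.T α a b c), gen_T_mem α a b c⟩
  antisymm α a b c := by
    rw [← map_neg]
    exact congrArg l (Subtype.ext (gen_T_antisymm α a b c))
  cyclic α a b c := by
    rw [← map_add, ← map_add, ← map_zero l]
    exact congrArg l (Subtype.ext (gen_T_cyclic α a b c))

theorem FieldJet.eval_ofLinear (l : spanT D →ₗ[ℝ] ℝ) (x : spanT D) :
    (FieldJet.ofLinear l).eval x = l x := by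
  obtain ⟨x, hx⟩ := x
  unfold spanT at hx
  induction hx using Submodule.span_induction with
  | mem x hx =>
    obtain ⟨α, a, b, c, rfl⟩ := hx
    exact eval_gen _ _
  | zero => rw [map_zero]; exact (map_zero l).symm
  | add x y hx hy h1 h2 =>
    rw [map_add, h1, h2]
    exact (map_add l ⟨x, hx⟩ ⟨y, hy⟩).symm
  | smul r x hx h1 =>
    rw [map_smul, h1]
    exact (map_smul l r ⟨x, hx⟩).symm

open scoped IsMulCommutative in
/-- A local function of the fields is determined by its values. -/
theorem eq_zero_of_eval_eq_zero {f : Alg D} (hf : f ∈ fieldAlg D)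
    (h0 : ∀ t : FieldJet D, t.eval f = 0) : f = 0 := by
  have : IsMulCommutative (fieldAlg D) := Algebra.isMulCommutative_adjoin ℝ (by
    rintro _ ⟨α, a, b, c, -, rfl⟩ _ ⟨β, d, e, g, -, rfl⟩
    rw [gen_supercomm]
    simp [koszul, Var.odd])
  -- A basis of the span of ∂…T absorbs the index symmetries: f becomes an ordinary polynomial in
  -- independent variables, and jets realize every assignment of values to them.
  let B := Module.Basis.ofVectorSpace ℝ (spanT D)
  let φ : MvPolynomial (Module.Basis.ofVectorSpaceIndex ℝ (spanT D)) ℝ →ₐ[ℝ] fieldAlg D :=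
    MvPolynomial.aeval fun i => ⟨B i, spanT_le_fieldAlg (B i).2⟩
  have hφ : ∀ i, (φ (MvPolynomial.X i) : Alg D) = B i := fun i => by
    simp only [φ, MvPolynomial.aeval_X]
  have hspan : ∀ x : spanT D, ∃ P, (φ P : Alg D) = x := fun x => by
    induction B.mem_span x using Submodule.span_induction with
    | mem x hx =>
      obtain ⟨i, rfl⟩ := hx
      exact ⟨_, hφ i⟩
    | zero => exact ⟨0, by rw [map_zero]; rfl⟩
    | add x y _ _ h1 h2 =>
      obtain ⟨P, hP⟩ := h1
      obtain ⟨Q, hQ⟩ := h2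
      refine ⟨P + Q, ?_⟩
      rw [map_add, Submodule.coe_add, ← hP, ← hQ]
      rfl
    | smul r x _ h1 =>
      obtain ⟨P, hP⟩ := h1
      refine ⟨r • P, ?_⟩
      rw [map_smul, Submodule.coe_smul, ← hP]
      rfl
  have hsurj : ∃ P, (φ P : Alg D) = f := by
    clear h0
    unfold fieldAlg fieldAlgOrder at hf
    induction hf using Algebra.adjoin_induction with
    | mem x hx =>
      obtain ⟨α, a, b, c, -, rfl⟩ := hx
      exact hspan ⟨_, gen_T_mem α a b c⟩
    | algebraMap r => exact ⟨algebraMap ℝ _ r, by rw [AlgHom.commutes]; rfl⟩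
    | add x y _ _ h1 h2 =>
      obtain ⟨P, rfl⟩ := h1
      obtain ⟨Q, rfl⟩ := h2
      exact ⟨P + Q, by rw [map_add]; rfl⟩
    | mul x y _ _ h1 h2 =>
      obtain ⟨P, rfl⟩ := h1
      obtain ⟨Q, rfl⟩ := h2
      exact ⟨P * Q, by rw [map_mul]; rfl⟩
  obtain ⟨P, rfl⟩ := hsurj
  have hP : P = 0 := by
    refine MvPolynomial.funext fun w => ?_
    have h1 := h0 (FieldJet.ofLinear (B.constr ℝ w))
    have h2 : ((FieldJet.ofLinear (B.constr ℝ w)).eval.comp (fieldAlg D).val).comp φ =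
        MvPolynomial.aeval w := by
      refine MvPolynomial.algHom_ext fun i => ?_
      rw [MvPolynomial.aeval_X]
      change FieldJet.eval _ (φ (MvPolynomial.X i) : Alg D) = _
      rw [hφ, FieldJet.eval_ofLinear, Module.Basis.constr_basis]
    rw [map_zero, ← MvPolynomial.coe_aeval_eq_eval]
    change MvPolynomial.aeval w P = 0
    rw [← h2]
    exact h1
  rw [hP, map_zero]
  rfl

theorem curlF_mem_fieldAlgOrder (α : Multiset (Fin D)) (a b c d e : Fin D) :
    curlF α a b c d e ∈ fieldAlgOrder D (fun k => 2 ≤ k) := by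
  have h : ∀ (x y a b c : Fin D), gen (.T (x ::ₘ y ::ₘ α) a b c) ∈
      fieldAlgOrder D (fun k => 2 ≤ k) := fun x y a b c =>
    Algebra.subset_adjoin ⟨_, _, _, _, by simp, rfl⟩
  exact sub_mem (add_mem (add_mem (h _ _ _ _ _) (h _ _ _ _ _)) (h _ _ _ _ _))
    (add_mem (add_mem (h _ _ _ _ _) (h _ _ _ _ _)) (h _ _ _ _ _))

theorem adjoin_setE_le_fieldAlgOrder :
    Algebra.adjoin ℝ (setE D) ≤ fieldAlgOrder D (fun k => 2 ≤ k) := by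
  rw [Algebra.adjoin_le_iff]
  rintro _ ⟨m, i, rfl⟩
  obtain ⟨r, -, hr⟩ := exists_ET_eq_smul_curlPlace (D := D) m
  rw [hr]
  exact Subalgebra.smul_mem _ (curlF_mem_fieldAlgOrder _ _ _ _ _ _) r

theorem fieldAlgOrder_le (p : ℕ → Prop) : fieldAlgOrder D p ≤ fieldAlg D :=
  Algebra.adjoin_mono fun _ ⟨α, a, b, c, _, hx⟩ => ⟨α, a, b, c, trivial, hx⟩

/-- A gauge transformation acts on linear functions of the field through `γ`. -/
theorem exists_eval_transform (e : SymmJet D) (η : AntisymmJet D) :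
    ∃ L : Alg D →ₗ[ℝ] ℝ, ∀ (t : FieldJet D), ∀ x ∈ spanT D,
      (t.transform e η).eval x = t.eval x + L (gamma D x) := by
  obtain ⟨L, hL⟩ := exists_linear (fun _ _ _ _ => (0 : ℝ)) e.val η.val (fun _ _ => 0)
    (by simp) (by simp) e.symm η.antisymm
  refine ⟨L, fun t x hx => ?_⟩
  unfold spanT at hx
  induction hx using Submodule.span_induction with
  | mem x hx =>
    obtain ⟨α, a, b, c, rfl⟩ := hx
    simp only [FieldJet.eval_gen, FieldJet.evalVar, FieldJet.transform, gamma_gen, gammaVar,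
      map_sub, map_add, map_smul, hL, valVar, smul_eq_mul]
  | zero => simp
  | add x y _ _ h1 h2 => simp only [map_add, h1, h2]; ring
  | smul r x _ h1 => simp only [map_smul, h1, smul_eq_mul]; ring

theorem gaugeInvariant_of_mem_adjoin {f : Alg D} (hf : f ∈ Algebra.adjoin ℝ (setE D)) :
    GaugeInvariant f := by
  intro t e η
  induction hf using Algebra.adjoin_induction with
  | mem x hx =>
    obtain ⟨m, i, rfl⟩ := hx
    obtain ⟨L, hL⟩ := exists_eval_transform e η
    have hE := ET_mem_spanCurl m i
    rw [hL t _ (spanCurl_le_spanT hE), gamma_spanCurl hE, map_zero, add_zero]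
  | algebraMap r => rw [AlgHom.commutes, AlgHom.commutes]
  | add x y _ _ h1 h2 => rw [map_add, map_add, h1, h2]
  | mul x y _ _ h1 h2 => rw [map_mul, map_mul, h1, h2]

/-- Gauge fixing: transforming with the parameters -hS and -hA evaluated at the jet itself replaces
T by T - hγT, a combination of curls. An invariant f therefore takes the same values as a polynomial
in the E^T, and equals it. -/
theorem mem_adjoin_of_gaugeInvariant {f : Alg D} (hf : f ∈ fieldAlg D) (hinv : GaugeInvariant f) :
    f ∈ Algebra.adjoin ℝ (setE D) := by
  obtain ⟨h, hh⟩ := exists_isHomotopy D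
  let e : FieldJet D → SymmJet D := fun t =>
    ⟨fun α a b => -t.eval (h (gen (.S α a b))), fun α a b => by rw [gen_S_symm]⟩
  let η : FieldJet D → AntisymmJet D := fun t =>
    ⟨fun α a b => -t.eval (h (gen (.A α a b))), fun α a b => by
      rw [gen_A_antisymm, map_neg, map_neg]⟩
  have key : ∃ g ∈ Algebra.adjoin ℝ (setE D), ∀ t : FieldJet D,
      (t.transform (e t) (η t)).eval f = t.eval g := by
    clear hinv
    unfold fieldAlg fieldAlgOrder at hf
    induction hf using Algebra.adjoin_induction with
    | mem x hx =>
      obtain ⟨α, a, b, c, -, rfl⟩ := hx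
      refine ⟨-(h (gamma D (gen (.T α a b c))) - gen (.T α a b c)), Subalgebra.neg_mem _
        (spanCurl_le_adjoin_setE (hh.spanT_gamma _ (gen_T_mem α a b c))), fun t => ?_⟩
      simp only [FieldJet.eval_gen, FieldJet.evalVar, FieldJet.transform, gamma_gen, gammaVar,
        map_sub, map_add, map_smul, map_neg, smul_eq_mul, e, η]
      ring
    | algebraMap r =>
      exact ⟨_, Subalgebra.algebraMap_mem _ r, fun t => by rw [AlgHom.commutes, AlgHom.commutes]⟩
    | add x y _ _ h1 h2 =>
      obtain ⟨g, hg, hg'⟩ := h1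
      obtain ⟨k, hk, hk'⟩ := h2
      exact ⟨g + k, add_mem hg hk, fun t => by rw [map_add, map_add, hg', hk']⟩
    | mul x y _ _ h1 h2 =>
      obtain ⟨g, hg, hg'⟩ := h1
      obtain ⟨k, hk, hk'⟩ := h2
      exact ⟨g * k, mul_mem hg hk, fun t => by rw [map_mul, map_mul, hg', hk']⟩
  obtain ⟨g, hg, hfg⟩ := key
  have h1 : f - g = 0 := eq_zero_of_eval_eq_zero
    (sub_mem hf (fieldAlgOrder_le _ (adjoin_setE_le_fieldAlgOrder hg))) fun t => by
      rw [map_sub, ← hfg, hinv, sub_self]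
  rwa [sub_eq_zero.mp h1]

/-- Truncate the jet to orders at most one. An f of low order does not see the truncation, while an
f of order at least two cannot distinguish the truncated jet from zero. -/
theorem eq_algebraMap_of_mem_order {f : Alg D} (h2 : f ∈ fieldAlgOrder D (fun k => 2 ≤ k))
    (h1 : f ∈ fieldAlgOrder D (fun k => k ≤ 1)) : ∃ r : ℝ, f = algebraMap ℝ (Alg D) r := by
  let z : FieldJet D := ⟨fun _ _ _ _ => 0, by simp, by simp⟩
  refine ⟨z.eval f, sub_eq_zero.mp (eq_zero_of_eval_eq_zero
    (sub_mem (fieldAlgOrder_le _ h1) (Subalgebra.algebraMap_mem _ _)) fun t => ?_)⟩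
  let t' : FieldJet D := ⟨fun α a b c => if Multiset.card α ≤ 1 then t.val α a b c else 0,
    fun α a b c => by split_ifs; exacts [t.antisymm α a b c, by simp],
    fun α a b c => by split_ifs; exacts [t.cyclic α a b c, by simp]⟩
  have e1 : t.eval f = t'.eval f := FieldJet.eval_congr h1 fun α a b c hα => (if_pos hα).symm
  have e2 : t'.eval f = z.eval f := FieldJet.eval_congr h2 fun α a b c hα =>
    if_neg (by omega)
  rw [map_sub, AlgHom.commutes, e1, e2, Algebra.algebraMap_self_apply, sub_self]

end MixedGauge

end

theorem mainTheorem1 (D : ℕ) :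
    -- the generators are cocycles, and `H(γ)` is exactly the algebra that they generate
    (∃ h : ∀ b ∈ MixedGauge.invariantAlg D, b ∈ MixedGauge.cocycles D,
      Function.Bijective (fun b : MixedGauge.invariantAlg D =>
        (Submodule.Quotient.mk ⟨(b : MixedGauge.Alg D), h b b.2⟩ :
          MixedGauge.Cohomology D))) ∧
    -- the `E^T` with `m + 2` derivatives are the `m`-th derivatives of the curl of `F`
    (∀ m : ℕ,
      Submodule.span ℝ (Set.range (MixedGauge.ET (D := D) m)) =
        Submodule.span ℝ {x | ∃ (α : Multiset (Fin D)) (a b c d e : Fin D),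
          Multiset.card α = m ∧ x = MixedGauge.curlF α a b c d e}) ∧
    -- strictly gauge invariant local functions of the fields
    (∀ f ∈ MixedGauge.fieldAlg D,
      (MixedGauge.GaugeInvariant f ↔ MixedGauge.gamma D f = 0) ∧
      (MixedGauge.GaugeInvariant f ↔ f ∈ Algebra.adjoin ℝ (MixedGauge.setE D)) ∧
      (MixedGauge.GaugeInvariant f →
        f ∈ MixedGauge.fieldAlgOrder D (fun k => 2 ≤ k) ∧
        (f ∈ MixedGauge.fieldAlgOrder D (fun k => k ≤ 1) →
          ∃ r : ℝ, f = algebraMap ℝ (MixedGauge.Alg D) r))) := by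
  open MixedGauge in
  refine ⟨bijective_invariantAlg D, span_ET, fun f hf => ?_⟩
  have inv : GaugeInvariant f ↔ f ∈ Algebra.adjoin ℝ (setE D) :=
    ⟨mem_adjoin_of_gaugeInvariant hf, gaugeInvariant_of_mem_adjoin⟩
  refine ⟨inv.trans ⟨fun h => gamma_invariantAlg (adjoin_setE_le h), fun h => ?_⟩, inv,
    fun h => ?_⟩
  · obtain ⟨k, hk⟩ := exists_isHomotopy D
    exact hk.mem_adjoin_of_gamma_eq_zero hf h
  · have h2 := adjoin_setE_le_fieldAlgOrder (inv.mp h)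
    exact ⟨h2, eq_algebraMap_of_mem_order h2⟩
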